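/- Fix a critical exponent $\alpha>1$. **Lorenz maps.** For $c\in(0,1)$ and $u,v\in[0,1]$ let $q(x)=u\bigl(1-(\tfrac{c-x}{c})^\alpha\bigr)$ for $x\in[0,c)$ and $q(x)=1+v\bigl(-1+(\tfrac{x-c}{1-c})^\alpha\bigr)$ for $x\in(c,1]$. A Lorenz map is a map $f:[0,1]\setminus\{c\}\to[0,1]$ with $f=\phi_-\circ q$ on $[0,c)$ and $f=\phi_+\circ q$ on $(c,1]$, where the diffeomorphic parts $\phi_\pm$ are increasing $C^3$-diffeomorphisms of $[0,1]$ with nonpositive Schwarzian derivative, $f_+(c)\le c\le f_-(c)$ for the one-sided limits $f_-(c)=\phi_-(u)$, $f_+(c)=\phi_+(1-v)$, and the only fixed points are $0$ and $1$. It is nontrivial if $f_+(c)<c<f_-(c)$; a branch with $f_\pm(c)=c$ is called trivial. It is $\epsilon$-close to standard maps if both $\phi_\pm$ have $C^2$-distance at most $\epsilon$ to the identity. **Renormalization.** A return interval of $f$ is a closed interval $C\subsetneq[0,1]$, with $c$ in its interior, such that the first-return map to $C$, affinely rescaled to $[0,1]$, is a Lorenz map. Let $C$ be the largest one, $C^-=C\cap[0,c)$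 and $C^+=C\cap(c,1]$. For integers $a,b\ge1$ the return is of monotone type $(a,b)$ if the points of $C^-$ first return at time $a+1$ and are to the right of $c$ at times $1,\dots,a$, and the points of $C^+$ first return at time $b+1$ and are to the left of $c$ at times $1,\dots,b$. The rescaled return map is then the renormalization $\mathcal Rf$; its diffeomorphic parts are the affine rescalings to $[0,1]$ of the monotone branches of $f_+^a\circ\phi_-$ and $f_-^b\circ\phi_+$ onto $C$ (from the subintervals of $[0,1]$ which they map onto $C$). The map $f$ is $(a,b)$-renormalizable if moreover $\mathcal Rf$ is nontrivial. The gaps $G^-$ and $G^+$ are the connected components, adjacent to $C$ at the left and at the right, of the complement in $[0,1]$ of the union of the intervals $\overline{f^k(C^-)}$, $0\le k\le a$, and $\overline{f^k(C^+)}$, $0\le k\le b$. **Families.** A family is a map $\lambda\mapsto F_\lambda$ to Lorenz maps, defined on a compact simply connected $U\subset\mathbb R^2$, such that $c,u,v$ and $\phi_\pm\in C^2([0,1])$ depend continuously on $\lambda$ and $F_\lambda$ is nontrivial for $\lambda$ in the interior of $U$. It is analytic if these dependences are real-analytic, and full if for every nontrivial Lorenz map $g$ some $F_\lambda$ has the same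 kneading invariants as $g$ (the same left/right itineraries of $c^-$ and of $c^+$). The archipelago $A_{a,b}$ is the set of $\lambda\in U$ for which $F_\lambda$ is $(a,b)$-renormalizable. An island is the closure of a connected component of the interior of $A_{a,b}$. A full island $D_{a,b}$ is an island on which every $F_\lambda$ has a renormalization of monotone type $(a,b)$ (possibly with trivial branches on the boundary) and on which $\lambda\mapsto\mathcal RF_\lambda$ is a full family. **Statement.** There is $\delta>0$, depending only on $\alpha$, such that the following holds for every analytic full family $F$ all of whose maps are $\delta$-close to standard maps. For every $\epsilon>0$ there exists $N\ge1$ such that, if $a,b\ge N$ and $D_{a,b}$ is a full island of $A_{a,b}$, then for every map $f=F_\lambda$ with $\lambda\in D_{a,b}$ both gaps $G^\pm$ have positive length, $$\max\left\{\frac{|C|}{|G^-|},\frac{|C|}{|G^+|}\right\}\le\epsilon ,$$ and $\mathcal Rf$ is $\epsilon$-close to standard maps. -/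

import Mathlib

open Set Filter Topology MeasureTheory

noncomputable section

/-- The Schwarzian derivative `φ''' / φ' - (3/2) (φ'' / φ')²` of a map of `[0,1]`
(one-sided derivatives at the endpoints). -/
def schwarzianOn (φ : ℝ → ℝ) (x : ℝ) : ℝ :=
  iteratedDerivWithin 3 φ (Icc 0 1) x / derivWithin φ (Icc 0 1) x
    - 3 / 2 * (iteratedDerivWithin 2 φ (Icc 0 1) x / derivWithin φ (Icc 0 1) x) ^ 2

/-- Increasing `C³`-diffeomorphisms of `[0,1]` with nonpositive Schwarzian derivative
(the identity is allowed). Values outside `[0,1]` are irrelevant. -/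
structure LorenzDiffeo where
  toFun : ℝ → ℝ
  map_zero : toFun 0 = 0
  map_one : toFun 1 = 1
  contDiffOn : ContDiffOn ℝ 3 toFun (Icc 0 1)
  deriv_pos : ∀ x ∈ Icc (0 : ℝ) 1, 0 < derivWithin toFun (Icc 0 1) x
  schwarzian_nonpos : ∀ x ∈ Icc (0 : ℝ) 1, schwarzianOn toFun x ≤ 0

/-- The `k`-th derivative, `k ≤ 2`, as an element of the Banach space `C([0,1])`. The three
of them together are the image of the diffeomorphism in the Banach space `C²([0,1])`. -/
def LorenzDiffeo.jet (φ : LorenzDiffeo) (k : Fin 3) : C(Icc (0 : ℝ) 1, ℝ) where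
  toFun x := iteratedDerivWithin k φ.toFun (Icc 0 1) x
  continuous_toFun := by
    have h := φ.contDiffOn.continuousOn_iteratedDerivWithin (m := (k : ℕ))
      (by exact_mod_cast (show (k : ℕ) ≤ 3 by omega)) (uniqueDiffOn_Icc zero_lt_one)
    exact continuousOn_iff_continuous_domRestrict.mp h

/-- The `C²`-distance to the identity is at most `ε`. -/
def LorenzDiffeo.CloseToId (φ : LorenzDiffeo) (ε : ℝ) : Prop :=
  ∀ x ∈ Icc (0 : ℝ) 1, |φ.toFun x - x| ≤ ε ∧
    |derivWithin φ.toFun (Icc 0 1) x - 1| ≤ ε ∧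
    |iteratedDerivWithin 2 φ.toFun (Icc 0 1) x| ≤ ε

/-- The standard Lorenz map with critical exponent `α`, critical point `c` and critical values
`u`, `1 - v`. Its value at `x = c` is irrelevant. -/
def standardLorenz (α u v c x : ℝ) : ℝ :=
  if x < c then u * (1 - ((c - x) / c) ^ α) else 1 + v * (-1 + ((x - c) / (1 - c)) ^ α)

/-- A Lorenz map with critical exponent `α`, given by its standard part `(u, v, c)` and its
diffeomorphic parts. The last four fields say that `f₊(c) ≤ c ≤ f₋(c)`, i.e. each branch is
trivial or has the critical point in the interior of its image, and that
`0`, `1` are the only fixed points. -/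
structure LorenzMap (α : ℝ) where
  c : ℝ
  u : ℝ
  v : ℝ
  phiMinus : LorenzDiffeo
  phiPlus : LorenzDiffeo
  c_mem : c ∈ Ioo (0 : ℝ) 1
  u_mem : u ∈ Icc (0 : ℝ) 1
  v_mem : v ∈ Icc (0 : ℝ) 1
  le_critMinus : c ≤ phiMinus.toFun u
  critPlus_le : phiPlus.toFun (1 - v) ≤ c
  no_fixed_minus : ∀ x ∈ Ioo 0 c, phiMinus.toFun (standardLorenz α u v c x) ≠ x
  no_fixed_plus : ∀ x ∈ Ioo c 1, phiPlus.toFun (standardLorenz α u v c x) ≠ x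

namespace LorenzMap

variable {α : ℝ}

/-- The standard part `q` of a Lorenz map. -/
def std (f : LorenzMap α) (x : ℝ) : ℝ := standardLorenz α f.u f.v f.c x

/-- The map `f : [0,1] \ {c} → [0,1]` itself; its value at `c` is irrelevant. -/
def map (f : LorenzMap α) (x : ℝ) : ℝ :=
  if x < f.c then f.phiMinus.toFun (f.std x) else f.phiPlus.toFun (f.std x)

/-- Both branches have the critical point in the interior of their image: `f₊(c) < c < f₋(c)`,
where `f₋(c) = φ₋(u)` and `f₊(c) = φ₊(1 - v)` are the one-sided limits at `c`. -/
def IsNontrivial (f : LorenzMap α) : Prop :=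
  f.phiPlus.toFun (1 - f.v) < f.c ∧ f.c < f.phiMinus.toFun f.u

/-- `f` is `ε`-close to standard maps. -/
def CloseToStandard (f : LorenzMap α) (ε : ℝ) : Prop :=
  f.phiMinus.CloseToId ε ∧ f.phiPlus.CloseToId ε

/-- The `n`-th symbol of the itinerary of `c⁻` is `L` (otherwise it is `R`). -/
def kneadingMinusIsL (f : LorenzMap α) (n : ℕ) : Prop :=
  ∀ᶠ x in 𝓝[<] f.c, f.map^[n] x < f.c

/-- The `n`-th symbol of the itinerary of `c⁺` is `L` (otherwise it is `R`). -/
def kneadingPlusIsL (f : LorenzMap α) (n : ℕ) : Prop :=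
  ∀ᶠ x in 𝓝[>] f.c, f.map^[n] x < f.c

/-- Two Lorenz maps have the same combinatorics: the same kneading invariants. -/
def SameCombinatorics (f g : LorenzMap α) : Prop :=
  ∀ n : ℕ, (f.kneadingMinusIsL n ↔ g.kneadingMinusIsL n) ∧
    (f.kneadingPlusIsL n ↔ g.kneadingPlusIsL n)

/-- `n` is the first-return time of `x` to `[p,q]`. -/
def IsFirstReturnTime (f : LorenzMap α) (p q x : ℝ) (n : ℕ) : Prop :=
  1 ≤ n ∧ f.map^[n] x ∈ Icc p q ∧ ∀ k, 1 ≤ k → k < n → f.map^[k] x ∉ Icc p q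

/-- The first-return map of `f` to `[p,q] \ {c}`, affinely rescaled to `[0,1]`, is the Lorenz
map `g`. -/
def IsReturnMap (f : LorenzMap α) (p q : ℝ) (g : LorenzMap α) : Prop :=
  f.c = p + (q - p) * g.c ∧
  ∀ x ∈ Icc (0 : ℝ) 1, x ≠ g.c → ∃ n, f.IsFirstReturnTime p q (p + (q - p) * x) n ∧
    f.map^[n] (p + (q - p) * x) = p + (q - p) * g.map x

/-- `[p,q]` is a proper subinterval of `[0,1]` with `c` in its interior, and the first-return
map to it is a Lorenz map. -/
def IsReturnInterval (f : LorenzMap α) (p q : ℝ) : Prop :=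
  0 ≤ p ∧ p < f.c ∧ f.c < q ∧ q ≤ 1 ∧ Icc p q ≠ Icc 0 1 ∧ ∃ g : LorenzMap α, f.IsReturnMap p q g

/-- `[p,q]` is the largest return interval. -/
def IsLargestReturnInterval (f : LorenzMap α) (p q : ℝ) : Prop :=
  f.IsReturnInterval p q ∧ ∀ p' q', f.IsReturnInterval p' q' → Icc p' q' ⊆ Icc p q

/-- The return to `C = [p,q]` is of monotone type `(a,b)`: `C⁻ = [p,c)` returns at time `a + 1`
and is to the right of `c` in between, `C⁺ = (c,q]` returns at time `b + 1` and is to the left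
of `c` in between. -/
def IsMonotoneType (f : LorenzMap α) (a b : ℕ) (p q : ℝ) : Prop :=
  1 ≤ a ∧ 1 ≤ b ∧
  (∀ x ∈ Ico p f.c, f.IsFirstReturnTime p q x (a + 1) ∧
    ∀ k, 1 ≤ k → k ≤ a → f.c < f.map^[k] x) ∧
  (∀ x ∈ Ioc f.c q, f.IsFirstReturnTime p q x (b + 1) ∧
    ∀ k, 1 ≤ k → k ≤ b → f.map^[k] x < f.c)

/-- `f` is `(a,b)`-renormalizable: the first-return map to the largest return interval is a
nontrivial Lorenz map and the return is of monotone type `(a,b)`. -/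
def IsRenormalizable (f : LorenzMap α) (a b : ℕ) : Prop :=
  ∃ p q, f.IsLargestReturnInterval p q ∧ f.IsMonotoneType a b p q ∧
    ∃ g : LorenzMap α, g.IsNontrivial ∧ f.IsReturnMap p q g

/-- The diffeomorphic parts of the Lorenz map `g`, the rescaled return map to `C = [p,q]`:
`g.phiMinus` is the rescaling of `f₊ᵃ ∘ φ₋ : [s,t] → C`, where `[s,t]` is the interval which this
monotone branch maps onto `C`, and the standard part of `g` left of its critical point is the
rescaling of `q : C⁻ → [s,t]`; similarly on the right with `f₋ᵇ ∘ φ₊`. -/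
def HasInducedParts (f : LorenzMap α) (a b : ℕ) (p q : ℝ) (g : LorenzMap α) : Prop :=
  (∃ s t, 0 ≤ s ∧ s < t ∧ t ≤ 1 ∧
    (∀ y ∈ Icc (0 : ℝ) 1,
      (∀ k < a, f.c < f.map^[k] (f.phiMinus.toFun (s + (t - s) * y))) ∧
      f.map^[a] (f.phiMinus.toFun (s + (t - s) * y)) = p + (q - p) * g.phiMinus.toFun y) ∧
    ∀ x ∈ Ico 0 g.c, f.std (p + (q - p) * x) = s + (t - s) * g.std x) ∧
  (∃ s t, 0 ≤ s ∧ s < t ∧ t ≤ 1 ∧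
    (∀ y ∈ Icc (0 : ℝ) 1,
      (∀ k < b, f.map^[k] (f.phiPlus.toFun (s + (t - s) * y)) < f.c) ∧
      f.map^[b] (f.phiPlus.toFun (s + (t - s) * y)) = p + (q - p) * g.phiPlus.toFun y) ∧
    ∀ x ∈ Ioc g.c 1, f.std (p + (q - p) * x) = s + (t - s) * g.std x)

/-- `g`, with its diffeomorphic parts, is the renormalization of `f`, of monotone type `(a,b)` and
with return interval `[p,q]`. Branches of `g` are allowed to be trivial. -/
def IsRenormalization (f : LorenzMap α) (a b : ℕ) (p q : ℝ) (g : LorenzMap α) : Prop :=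
  f.IsLargestReturnInterval p q ∧ f.IsMonotoneType a b p q ∧ f.IsReturnMap p q g ∧
    f.HasInducedParts a b p q g

/-- The union of the cycles of closed intervals `closure (fᵏ(C⁻))`, `0 ≤ k ≤ a`, and
`closure (fᵏ(C⁺))`, `0 ≤ k ≤ b`. -/
def cycles (f : LorenzMap α) (a b : ℕ) (p q : ℝ) : Set ℝ :=
  (⋃ k ∈ Finset.range (a + 1), closure (f.map^[k] '' Ico p f.c)) ∪
  (⋃ k ∈ Finset.range (b + 1), closure (f.map^[k] '' Ioc f.c q))

/-- The gap to the left of `C = [p,q]`: the connected component of the complement of the cycles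
in `[0,1]` which is adjacent to `p` (empty if there is none). -/
def leftGap (f : LorenzMap α) (a b : ℕ) (p q : ℝ) : Set ℝ :=
  {x | 0 ≤ x ∧ x < p ∧ ∀ y ∈ Ico x p, y ∉ f.cycles a b p q}

/-- The gap to the right of `C = [p,q]`. -/
def rightGap (f : LorenzMap α) (a b : ℕ) (p q : ℝ) : Set ℝ :=
  {x | q < x ∧ x ≤ 1 ∧ ∀ y ∈ Ioc q x, y ∉ f.cycles a b p q}

/-- A family of Lorenz maps over a compact and simply connected parameter set, continuous for the
`C²`-topology. Trivial branches are allowed on the boundary only. -/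
structure IsFamily (U : Set (ℝ × ℝ)) (F : ℝ × ℝ → LorenzMap α) : Prop where
  compact : IsCompact U
  simplyConnected : SimplyConnectedSpace U
  nontrivial : ∀ l ∈ interior U, (F l).IsNontrivial
  continuous_c : ContinuousOn (fun l => (F l).c) U
  continuous_u : ContinuousOn (fun l => (F l).u) U
  continuous_v : ContinuousOn (fun l => (F l).v) U
  continuous_phiMinus : ∀ k, ContinuousOn (fun l => (F l).phiMinus.jet k) U
  continuous_phiPlus : ∀ k, ContinuousOn (fun l => (F l).phiPlus.jet k) U

/-- A full family: it realizes the combinatorics of every nontrivial Lorenz map. -/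
def IsFullFamily (U : Set (ℝ × ℝ)) (F : ℝ × ℝ → LorenzMap α) : Prop :=
  IsFamily U F ∧ ∀ g : LorenzMap α, g.IsNontrivial → ∃ l ∈ U, (F l).SameCombinatorics g

/-- The family depends real-analytically on the parameter: the critical point and `u`, `v` do, and
so do the diffeomorphic parts as elements of `C²([0,1])`. -/
structure IsAnalyticFamily (U : Set (ℝ × ℝ)) (F : ℝ × ℝ → LorenzMap α) : Prop where
  analytic_c : AnalyticOn ℝ (fun l => (F l).c) U
  analytic_u : AnalyticOn ℝ (fun l => (F l).u) U
  analytic_v : AnalyticOn ℝ (fun l => (F l).v) U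
  analytic_phiMinus : ∀ k, AnalyticOn ℝ (fun l => (F l).phiMinus.jet k) U
  analytic_phiPlus : ∀ k, AnalyticOn ℝ (fun l => (F l).phiPlus.jet k) U

/-- The `(a,b)`-archipelago. -/
def archipelago (U : Set (ℝ × ℝ)) (F : ℝ × ℝ → LorenzMap α) (a b : ℕ) : Set (ℝ × ℝ) :=
  {l | l ∈ U ∧ (F l).IsRenormalizable a b}

/-- An `(a,b)`-island: the closure of a connected component of the interior of the archipelago. -/
def IsIsland (U : Set (ℝ × ℝ)) (F : ℝ × ℝ → LorenzMap α) (a b : ℕ) (D : Set (ℝ × ℝ)) : Prop :=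
  ∃ l ∈ interior (archipelago U F a b),
    D = closure (connectedComponentIn (interior (archipelago U F a b)) l)

/-- A full `(a,b)`-island: every map in it has a renormalization of type `(a,b)` (which may have
trivial branches on the boundary of the island), and the renormalizations form a full family. -/
def IsFullIsland (U : Set (ℝ × ℝ)) (F : ℝ × ℝ → LorenzMap α) (a b : ℕ) (D : Set (ℝ × ℝ)) :
    Prop :=
  IsIsland U F a b D ∧ ∃ R : ℝ × ℝ → LorenzMap α,
    (∀ l ∈ D, ∃ p q, (F l).IsRenormalization a b p q (R l)) ∧ IsFullFamily D R

end LorenzMap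

end

/-! The only global input is compactness: over `U` the critical point stays in some `[c₀, 1 - c₀]`
(`IsFamily.exists_c_mem_Icc`), and all estimates are uniform in `α`, `c₀`.

Put `x = c - f₊(c)` and `y = f₋(c) - c`. If `a, b ≥ 2`, the orbits of the endpoints of `C` give `x ≤
2 (y/c₀)^α` and `y ≤ 2 (x/c₀)^α`. Multiplying, `xy ≤ 4 (xy/c₀²)^α`, and `α > 1` forces `x, y ≥ η`
for a constant `η` (`critMargin_le_crit`).

With `δ = (α - 1)/(2α)` the bending of `φ₊` cannot destroy the convexity of the power law, so the
right branch is convex and lies below the chord from `(c, c - η)` to `(1, 1)`. Hence it repels from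
`1` at rate at least `1 + η` (`ExpandingBranch.expand_one`). Three consequences follow for points of
`C⁻`, whose orbits spend `a` steps to the right of `c`.

Size: their first images are exponentially close to `1` in `a`, so `c - p` tends to `0`
(`c_sub_le`). Gaps: their intermediate images are sent to the right of `c - η/2`, whereas `f₊(c) ≤ c
- η`, so they keep a definite distance from `c`. The gap at the right of `C` therefore has definite
length (`le_volume_rightGap`). Distortion: away from `c` the logarithm of the derivative is
Lipschitz, and the images of an interval along the orbit have total length at most a constant times
the last one, which lies in `C` (`ExpandingBranch.sum_orbit_le`). So the long composition is nearly
affine, also in the `C²` sense (`LorenzDiffeo.closeToId_of_abs_log_deriv_sub_le`).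

The left branch is the right branch of the map conjugated by `x ↦ 1 - x`. -/

/-! ### Calculus of maps near the identity -/

theorem abs_log_sub_log_le {m x y : ℝ} (hm : 0 < m) (hx : m ≤ x) (hy : m ≤ y) :
    |Real.log x - Real.log y| ≤ |x - y| / m := by
  wlog h : y ≤ x generalizing x y
  · rw [abs_sub_comm, abs_sub_comm x y]
    exact this hy hx (le_of_not_ge h)
  have hy0 : 0 < y := hm.trans_le hy
  have hx0 : 0 < x := hm.trans_le hx
  rw [abs_of_nonneg (sub_nonneg.2 (Real.log_le_log hy0 h)), abs_of_nonneg (sub_nonneg.2 h),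
    ← Real.log_div hx0.ne' hy0.ne']
  calc Real.log (x / y) ≤ x / y - 1 := Real.log_le_sub_one_of_pos (div_pos hx0 hy0)
    _ = (x - y) / y := by field_simp
    _ ≤ (x - y) / m := div_le_div_of_nonneg_left (sub_nonneg.2 h) hm hy

theorem HasDerivWithinAt.norm_le_of_forall {f : ℝ → ℝ} {f' K x : ℝ} {s : Set ℝ}
    (h : HasDerivWithinAt f f' s x) (hs : UniqueDiffWithinAt ℝ s x)
    (hK : ∀ y ∈ s, ‖f y - f x‖ ≤ K * |y - x|) : ‖f'‖ ≤ K := by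
  have : (𝓝[s \ {x}] x).NeBot := accPt_principal_iff_nhdsWithin.1 hs.accPt
  refine le_of_tendsto (hasDerivWithinAt_iff_tendsto_slope.1 h).norm ?_
  filter_upwards [self_mem_nhdsWithin] with y hy
  have hyx : 0 < |y - x| := abs_pos.2 (sub_ne_zero.2 hy.2)
  rw [slope_def_field, norm_div, Real.norm_eq_abs (y - x), div_le_iff₀ hyx]
  exact hK y hy.1

/-- `φ` is a `C^{1,1}` map of `[0,1]` with derivative `D`, fixing the endpoints and `δ`-close to the
identity. -/
structure NearIdentity (δ : ℝ) (φ D : ℝ → ℝ) : Prop where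
  map_zero : φ 0 = 0
  map_one : φ 1 = 1
  hasDeriv : ∀ x ∈ Icc (0 : ℝ) 1, HasDerivWithinAt φ (D x) (Icc 0 1) x
  close : ∀ x ∈ Icc (0 : ℝ) 1, |D x - 1| ≤ δ
  lip : ∀ x ∈ Icc (0 : ℝ) 1, ∀ y ∈ Icc (0 : ℝ) 1, |D x - D y| ≤ δ * |x - y|

namespace NearIdentity

variable {δ : ℝ} {φ D : ℝ → ℝ}

theorem exists_slope (h : NearIdentity δ φ D) {x y : ℝ} (hx : 0 ≤ x) (hxy : x ≤ y) (hy : y ≤ 1) :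
    ∃ m, |m - 1| ≤ δ ∧ φ y - φ x = m * (y - x) := by
  rcases hxy.eq_or_lt with rfl | hlt
  · exact ⟨D x, h.close x ⟨hx, hy⟩, by ring⟩
  · have hsub : Icc x y ⊆ Icc 0 1 := Icc_subset_Icc hx hy
    obtain ⟨z, hz, hz'⟩ := exists_hasDerivAt_eq_slope φ D hlt
      (fun w hw => ((h.hasDeriv w (hsub hw)).continuousWithinAt).mono hsub)
      (fun w hw => (h.hasDeriv w (hsub (Ioo_subset_Icc_self hw))).hasDerivAt
        (Icc_mem_nhds (hx.trans_lt hw.1) (hw.2.trans_le hy)))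
    refine ⟨D z, h.close z (hsub (Ioo_subset_Icc_self hz)), ?_⟩
    rw [hz', div_mul_cancel₀ _ (sub_pos.2 hlt).ne']

theorem sub_le (h : NearIdentity δ φ D) (hδ : δ ≤ 1 / 2) {x y : ℝ} (hx : 0 ≤ x) (hxy : x ≤ y)
    (hy : y ≤ 1) : φ y - φ x ≤ 2 * (y - x) := by
  obtain ⟨m, hm, e⟩ := h.exists_slope hx hxy hy
  rw [e]
  have := (abs_le.1 hm).2
  exact mul_le_mul_of_nonneg_right (by linarith) (sub_nonneg.2 hxy)

theorem le_sub (h : NearIdentity δ φ D) (hδ : δ ≤ 1 / 2) {x y : ℝ} (hx : 0 ≤ x) (hxy : x ≤ y)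
    (hy : y ≤ 1) : (y - x) / 2 ≤ φ y - φ x := by
  obtain ⟨m, hm, e⟩ := h.exists_slope hx hxy hy
  rw [e, div_eq_inv_mul]
  have := (abs_le.1 hm).1
  exact mul_le_mul_of_nonneg_right (by linarith) (sub_nonneg.2 hxy)

theorem monotone (h : NearIdentity δ φ D) (hδ : δ ≤ 1 / 2) {x y : ℝ} (hx : 0 ≤ x) (hxy : x ≤ y)
    (hy : y ≤ 1) : φ x ≤ φ y := by
  have := h.le_sub hδ hx hxy hy
  linarith

theorem mem_Icc (h : NearIdentity δ φ D) (hδ : δ ≤ 1 / 2) {x : ℝ} (hx : x ∈ Icc (0 : ℝ) 1) :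
    φ x ∈ Icc (0 : ℝ) 1 := by
  constructor
  · rw [← h.map_zero]; exact h.monotone hδ le_rfl hx.1 hx.2
  · rw [← h.map_one]; exact h.monotone hδ hx.1 hx.2 le_rfl

theorem half_le_deriv (h : NearIdentity δ φ D) (hδ : δ ≤ 1 / 2) {x : ℝ} (hx : x ∈ Icc (0 : ℝ) 1) :
    1 / 2 ≤ D x := by
  have := (abs_le.1 (h.close x hx)).1
  linarith

theorem abs_log_deriv_sub_le (h : NearIdentity δ φ D) (hδ : δ ≤ 1 / 2) {x y : ℝ}
    (hx : x ∈ Icc (0 : ℝ) 1) (hy : y ∈ Icc (0 : ℝ) 1) :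
    |Real.log (D x) - Real.log (D y)| ≤ |x - y| := by
  refine (abs_log_sub_log_le (by norm_num) (h.half_le_deriv hδ hx) (h.half_le_deriv hδ hy)).trans ?_
  have := h.lip x hx y hy
  have h2 : δ * |x - y| ≤ 1 / 2 * |x - y| := mul_le_mul_of_nonneg_right hδ (abs_nonneg _)
  linarith

/-- Conjugation by `x ↦ 1 - x` exchanges the two branches of a Lorenz map, so branch estimates need
proof for right branches only. -/
theorem flip (h : NearIdentity δ φ D) : NearIdentity δ (fun x => 1 - φ (1 - x)) fun x => D (1 - x) where
  map_zero := by simp [h.map_one]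
  map_one := by simp [h.map_zero]
  hasDeriv x hx := by
    have hx' : 1 - x ∈ Icc (0 : ℝ) 1 := ⟨by linarith [hx.2], by linarith [hx.1]⟩
    have h1 : HasDerivWithinAt (fun y : ℝ => 1 - y) (-1) (Icc 0 1) x := by
      simpa using (hasDerivWithinAt_id x (Icc (0 : ℝ) 1)).const_sub 1
    have h2 := ((h.hasDeriv _ hx').comp x h1
      (fun y hy => ⟨by linarith [hy.2], by linarith [hy.1]⟩)).const_sub 1
    simpa [Function.comp_def] using h2
  close x hx := h.close _ ⟨by linarith [hx.2], by linarith [hx.1]⟩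
  lip x hx y hy := by
    have := h.lip (1 - x) ⟨by linarith [hx.2], by linarith [hx.1]⟩
      (1 - y) ⟨by linarith [hy.2], by linarith [hy.1]⟩
    rwa [show 1 - x - (1 - y) = y - x by ring, abs_sub_comm y x] at this

end NearIdentity

/-! ### From logarithmic variation of the derivative to `C²`-distance -/

theorem LorenzDiffeo.hasDerivWithinAt (φ : LorenzDiffeo) {x : ℝ} (hx : x ∈ Icc (0 : ℝ) 1) :
    HasDerivWithinAt φ.toFun (derivWithin φ.toFun (Icc 0 1) x) (Icc 0 1) x :=
  ((φ.contDiffOn.differentiableOn (by norm_num)) x hx).hasDerivWithinAt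

theorem LorenzDiffeo.hasDerivWithinAt_derivWithin (φ : LorenzDiffeo) {x : ℝ}
    (hx : x ∈ Icc (0 : ℝ) 1) :
    HasDerivWithinAt (derivWithin φ.toFun (Icc 0 1))
      (iteratedDerivWithin 2 φ.toFun (Icc 0 1) x) (Icc 0 1) x := by
  have h1 : ContDiffOn ℝ 1 (derivWithin φ.toFun (Icc 0 1)) (Icc 0 1) :=
    φ.contDiffOn.derivWithin (uniqueDiffOn_Icc zero_lt_one) (by norm_num)
  have h2 := ((h1.differentiableOn (by norm_num)) x hx).hasDerivWithinAt
  rwa [← iteratedDerivWithin_one, ← iteratedDerivWithin_succ, iteratedDerivWithin_one] at h2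

theorem LorenzDiffeo.CloseToId.nearIdentity {φ : LorenzDiffeo} {δ : ℝ} (h : φ.CloseToId δ) :
    NearIdentity δ φ.toFun (derivWithin φ.toFun (Icc 0 1)) where
  map_zero := φ.map_zero
  map_one := φ.map_one
  hasDeriv x hx := φ.hasDerivWithinAt hx
  close x hx := (h x hx).2.1
  lip x hx y hy := by
    simpa using (convex_Icc (0 : ℝ) 1).norm_image_sub_le_of_norm_hasDerivWithin_le
      (fun z hz => φ.hasDerivWithinAt_derivWithin hz) (fun z hz => (h z hz).2.2) hy hx

theorem LorenzDiffeo.monotoneOn (φ : LorenzDiffeo) : MonotoneOn φ.toFun (Icc 0 1) := by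
  refine monotoneOn_of_deriv_nonneg (convex_Icc 0 1) φ.contDiffOn.continuousOn ?_ ?_
  · intro x hx
    rw [interior_Icc] at hx ⊢
    exact ((φ.hasDerivWithinAt (Ioo_subset_Icc_self hx)).hasDerivAt
      (Icc_mem_nhds hx.1 hx.2)).differentiableAt.differentiableWithinAt
  · intro x hx
    rw [interior_Icc] at hx
    rw [((φ.hasDerivWithinAt (Ioo_subset_Icc_self hx)).hasDerivAt (Icc_mem_nhds hx.1 hx.2)).deriv]
    exact (φ.deriv_pos x (Ioo_subset_Icc_self hx)).le

theorem LorenzDiffeo.mem_Icc (φ : LorenzDiffeo) {x : ℝ} (hx : x ∈ Icc (0 : ℝ) 1) :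
    φ.toFun x ∈ Icc (0 : ℝ) 1 :=
  ⟨φ.map_zero ▸ φ.monotoneOn (by simp) hx hx.1, φ.map_one ▸ φ.monotoneOn hx (by simp) hx.2⟩

/-- A diffeomorphism of `[0,1]` whose derivative has small logarithmic variation is close to the
identity. -/
theorem LorenzDiffeo.closeToId_of_abs_log_deriv_sub_le (φ : LorenzDiffeo) {E : ℝ} (hE : E ≤ 1 / 4)
    (h : ∀ x ∈ Icc (0 : ℝ) 1, ∀ y ∈ Icc (0 : ℝ) 1,
      |Real.log (derivWithin φ.toFun (Icc 0 1) x) - Real.log (derivWithin φ.toFun (Icc 0 1) y)|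
        ≤ E * (|φ.toFun x - φ.toFun y| + |x - y|)) :
    φ.CloseToId (12 * E) := by
  set D := derivWithin φ.toFun (Icc 0 1) with hD
  have hcont : ContinuousOn φ.toFun (Icc 0 1) := φ.contDiffOn.continuousOn
  have h0 : (0 : ℝ) ∈ Icc (0 : ℝ) 1 := by simp
  have h1 : (1 : ℝ) ∈ Icc (0 : ℝ) 1 := by simp
  have hrange : ∀ x ∈ Icc (0 : ℝ) 1, φ.toFun x ∈ Icc (0 : ℝ) 1 := fun x hx => φ.mem_Icc hx
  have hE0 : 0 ≤ E := by
    have := (abs_nonneg _).trans (h 1 h1 0 h0)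
    rw [φ.map_zero, φ.map_one] at this
    norm_num at this
    linarith
  -- Since both endpoints are fixed, the derivative equals `1` at some `w`; this turns the variation
  -- of `log D` into a bound on `log D` itself.
  obtain ⟨w, hw, hw'⟩ := exists_hasDerivAt_eq_slope φ.toFun D zero_lt_one hcont
    (fun x hx => (φ.hasDerivWithinAt (Ioo_subset_Icc_self hx)).hasDerivAt (Icc_mem_nhds hx.1 hx.2))
  rw [φ.map_zero, φ.map_one] at hw'
  norm_num at hw'
  have habs : ∀ x ∈ Icc (0 : ℝ) 1, ∀ y ∈ Icc (0 : ℝ) 1, |x - y| ≤ 1 := fun x hx y hy =>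
    abs_le.2 ⟨by linarith [hx.1, hy.2], by linarith [hx.2, hy.1]⟩
  have hlog : ∀ x ∈ Icc (0 : ℝ) 1, |Real.log (D x)| ≤ 2 * E := fun x hx => by
    have := h x hx w (Ioo_subset_Icc_self hw)
    rw [hw', Real.log_one, sub_zero] at this
    have h3 := habs _ (hrange x hx) _ (hrange w (Ioo_subset_Icc_self hw))
    have h4 := habs x hx w (Ioo_subset_Icc_self hw)
    nlinarith
  have hDpos : ∀ x ∈ Icc (0 : ℝ) 1, 0 < D x := fun x hx => φ.deriv_pos x hx
  have hD1 : ∀ x ∈ Icc (0 : ℝ) 1, |D x - 1| ≤ 4 * E := fun x hx => by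
    have h3 := Real.abs_exp_sub_one_le (x := Real.log (D x)) ((hlog x hx).trans (by linarith))
    rw [Real.exp_log (hDpos x hx)] at h3
    linarith [hlog x hx]
  have hD2 : ∀ x ∈ Icc (0 : ℝ) 1, D x ≤ 2 := fun x hx => by
    linarith [(abs_le.1 (hD1 x hx)).2]
  have hlip : ∀ x ∈ Icc (0 : ℝ) 1, ∀ y ∈ Icc (0 : ℝ) 1, |φ.toFun x - φ.toFun y| ≤ 2 * |x - y| :=
    fun x hx y hy => by
      simpa using (convex_Icc (0 : ℝ) 1).norm_image_sub_le_of_norm_hasDerivWithin_le (C := 2)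
        (fun z hz => φ.hasDerivWithinAt hz)
        (fun z hz => by rw [Real.norm_eq_abs, abs_of_pos (hDpos z hz)]; exact hD2 z hz) hy hx
  have hDD : ∀ x ∈ Icc (0 : ℝ) 1, |iteratedDerivWithin 2 φ.toFun (Icc 0 1) x| ≤ 6 * E := fun x hx => by
    have hder := (φ.hasDerivWithinAt_derivWithin hx).log (hDpos x hx).ne'
    -- `φ` is `2`-Lipschitz, so the hypothesis makes `log D` Lipschitz with constant `E (2 + 1)`,
    -- and its derivative is `φ'' / φ'`.
    have hb : ‖iteratedDerivWithin 2 φ.toFun (Icc 0 1) x / D x‖ ≤ 3 * E := by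
      refine hder.norm_le_of_forall (uniqueDiffOn_Icc zero_lt_one x hx) fun y hy => ?_
      have := h y hy x hx
      have := hlip y hy x hx
      rw [Real.norm_eq_abs]
      nlinarith
    rw [norm_div, Real.norm_eq_abs, Real.norm_eq_abs, abs_of_pos (hDpos x hx),
      div_le_iff₀ (hDpos x hx)] at hb
    nlinarith [hD2 x hx]
  intro x hx
  refine ⟨?_, by linarith [hD1 x hx], by linarith [hDD x hx]⟩
  have := (convex_Icc (0 : ℝ) 1).norm_image_sub_le_of_norm_hasDerivWithin_le (C := 4 * E)
    (f := fun y => φ.toFun y - y) (f' := fun y => D y - 1)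
    (fun z hz => (φ.hasDerivWithinAt hz).sub (hasDerivWithinAt_id z _))
    (fun z hz => hD1 z hz) h0 hx
  simp only [φ.map_zero, sub_zero, Real.norm_eq_abs] at this
  have h5 := habs x hx 0 h0
  rw [sub_zero] at h5
  nlinarith

/-! ### Summation of backward orbits -/

/-- Contraction towards a repelling fixed point with exponentially decaying distortion errors. -/
theorem sum_dist_le_of_contracting {r L : ℝ} (hr0 : 0 < r) (hr : r < 1) (hL : 0 ≤ L) {d e : ℕ → ℝ}
    {n : ℕ} (hd : ∀ j, 0 ≤ d j) (he0 : e 0 ≤ 1) (he : ∀ j < n, e (j + 1) ≤ r * e j)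
    (hde : ∀ j < n, d (j + 1) ≤ r * Real.exp (L * e (j + 1)) * d j) :
    ∑ j ∈ Finset.range n, d (j + 1) ≤ Real.exp (L / (1 - r)) / (1 - r) * d 0 := by
  have h1r : 0 < 1 - r := sub_pos.2 hr
  have hgeom : ∀ j, ∑ i ∈ Finset.range j, r ^ i ≤ (1 - r)⁻¹ := fun j => by
    rw [← tsum_geometric_of_lt_one hr0.le hr]
    exact (summable_geometric_of_lt_one hr0.le hr).sum_le_tsum _ fun i _ => by positivity
  have hej : ∀ j ≤ n, e j ≤ r ^ j := by
    intro j
    induction j with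
    | zero => intro _; simpa using he0
    | succ j ih =>
      intro hj
      rw [pow_succ']
      exact (he j hj).trans (mul_le_mul_of_nonneg_left (ih (by omega)) hr0.le)
  -- The errors `L * e j` decay geometrically, so the accumulated factor stays below `exp (L / (1 -
  -- r))` and the pure rate `r ^ j` survives.
  have hdj : ∀ j ≤ n, d j ≤ r ^ j * Real.exp (L * ∑ i ∈ Finset.range j, r ^ i) * d 0 := by
    intro j
    induction j with
    | zero => simp
    | succ j ih =>
      intro hj
      have h1 : e (j + 1) ≤ r ^ j := (hej (j + 1) hj).trans
        (pow_le_pow_of_le_one hr0.le hr.le (Nat.le_succ j))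
      calc d (j + 1) ≤ r * Real.exp (L * e (j + 1)) * d j := hde j hj
        _ ≤ r * Real.exp (L * r ^ j) * (r ^ j * Real.exp (L * ∑ i ∈ Finset.range j, r ^ i) * d 0) := by
          have := ih (by omega)
          have := hd j
          gcongr
        _ = _ := by rw [Finset.sum_range_succ, mul_add, Real.exp_add]; ring
  calc ∑ j ∈ Finset.range n, d (j + 1)
      ≤ ∑ j ∈ Finset.range n, r ^ j * (Real.exp (L / (1 - r)) * d 0) := by
        refine Finset.sum_le_sum fun j hj => ?_
        rw [Finset.mem_range] at hj
        refine (hdj (j + 1) hj).trans ?_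
        rw [mul_assoc]
        have := hd 0
        gcongr ?_ * (Real.exp ?_ * _)
        · exact pow_le_pow_of_le_one hr0.le hr.le (Nat.le_succ j)
        · rw [div_eq_mul_inv]
          exact mul_le_mul_of_nonneg_left (hgeom _) hL
    _ = (∑ j ∈ Finset.range n, r ^ j) * (Real.exp (L / (1 - r)) * d 0) := by rw [Finset.sum_mul]
    _ ≤ (1 - r)⁻¹ * (Real.exp (L / (1 - r)) * d 0) :=
        mul_le_mul_of_nonneg_right (hgeom n) (mul_nonneg (Real.exp_pos _).le (hd 0))
    _ = _ := by rw [div_eq_mul_inv]; ring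

/-! ### Convexity and expansion of a single branch -/

/-- The standard part of the right branch of a Lorenz map, as a function on `[c,1]`. -/
noncomputable def stdBranch (α v c x : ℝ) : ℝ := 1 + v * (-1 + ((x - c) / (1 - c)) ^ α)

/-- The derivative of `φ ∘ stdBranch α v c` when `D` is the derivative of `φ`. -/
noncomputable def branchDeriv (α v c : ℝ) (D : ℝ → ℝ) (x : ℝ) : ℝ :=
  D (stdBranch α v c x) * (v * (α * ((x - c) / (1 - c)) ^ (α - 1) / (1 - c)))

/-- Bernoulli's inequality for the concave power `(α - 1)/α`, applied to `w ^ α`. It supplies the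
value of `δ` needed for convexity. -/
theorem one_sub_rpow_sub_one_ge {α w : ℝ} (hα : 1 < α) (hw : 0 ≤ w) :
    (α - 1) / α * (1 - w ^ α) ≤ 1 - w ^ (α - 1) := by
  have hα0 : 0 < α := by linarith
  have h := rpow_one_add_le_one_add_mul_self (s := w ^ α - 1)
    (by linarith [Real.rpow_nonneg hw α]) (p := (α - 1) / α) (div_nonneg (by linarith) hα0.le)
    ((div_le_one hα0).2 (by linarith))
  rw [show 1 + (w ^ α - 1) = w ^ α by ring, ← Real.rpow_mul hw,
    mul_div_cancel₀ _ hα0.ne'] at h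
  linarith

/-- A right branch `φ ∘ stdBranch α v c` of a Lorenz map whose diffeomorphic part `φ` is close to
the identity and whose critical value lies at distance at least `η` to the left of `c`. -/
structure ExpandingBranch (α c₀ η v c : ℝ) (φ D : ℝ → ℝ) : Prop where
  one_lt : 1 < α
  near : NearIdentity ((α - 1) / (2 * α)) φ D
  c₀_pos : 0 < c₀
  c_nonneg : 0 ≤ c
  c₀_le : c₀ ≤ 1 - c
  v_pos : 0 < v
  v_le : v ≤ 1
  η_pos : 0 < η
  crit : φ (1 - v) ≤ c - η

theorem half_sub_one_div_le_half {α : ℝ} (hα : 1 < α) : (α - 1) / (2 * α) ≤ 1 / 2 := by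
  rw [div_le_div_iff₀ (by linarith) (by norm_num)]; linarith

theorem div_mem_Icc {c x : ℝ} (hc : c < 1) (hx : x ∈ Icc c 1) : (x - c) / (1 - c) ∈ Icc (0 : ℝ) 1 :=
  ⟨div_nonneg (by linarith [hx.1]) (by linarith),
    (div_le_one (by linarith)).2 (by linarith [hx.2])⟩

theorem stdBranch_mem_Icc {α v c x : ℝ} (hα : 0 < α) (hv : v ∈ Icc (0 : ℝ) 1) (hc : c < 1)
    (hx : x ∈ Icc c 1) : stdBranch α v c x ∈ Icc (0 : ℝ) 1 := by
  have hz := div_mem_Icc hc hx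
  have h0 := Real.rpow_nonneg hz.1 α
  have h1 := Real.rpow_le_one hz.1 hz.2 hα.le
  have hv0 := hv.1
  have hv1 := hv.2
  unfold stdBranch
  constructor <;> nlinarith

theorem stdBranch_mono {α v c x y : ℝ} (hα : 0 < α) (hv : 0 ≤ v) (hc : c < 1)
    (hx : c ≤ x) (hxy : x ≤ y) : stdBranch α v c x ≤ stdBranch α v c y := by
  unfold stdBranch
  have : 0 < 1 - c := by linarith
  have : 0 ≤ x - c := by linarith
  gcongr

theorem stdBranch_crit {α v c : ℝ} (hα : 0 < α) : stdBranch α v c c = 1 - v := by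
  simp [stdBranch, Real.zero_rpow hα.ne']; ring

theorem stdBranch_one {α v c : ℝ} (hc : c < 1) : stdBranch α v c 1 = 1 := by
  simp [stdBranch, div_self (sub_pos.2 hc).ne']

theorem hasDerivAt_stdBranch {α v c x : ℝ} (hc : c < 1) (hx : c < x) :
    HasDerivAt (stdBranch α v c) (v * (α * ((x - c) / (1 - c)) ^ (α - 1) / (1 - c))) x := by
  have h1 : HasDerivAt (fun y => (y - c) / (1 - c)) (1 / (1 - c)) x :=
    ((hasDerivAt_id x).sub_const c).div_const _
  have hz : (x - c) / (1 - c) ≠ 0 := (div_pos (by linarith) (by linarith)).ne'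
  have h2 := (((h1.rpow_const (p := α) (Or.inl hz)).const_add (-1)).const_mul v).const_add 1
  refine h2.congr_deriv ?_
  ring

namespace ExpandingBranch

variable {α c₀ η v c : ℝ} {φ D : ℝ → ℝ}

theorem c_lt (h : ExpandingBranch α c₀ η v c φ D) : c < 1 := by linarith [h.c₀_le, h.c₀_pos]

theorem α_pos (h : ExpandingBranch α c₀ η v c φ D) : 0 < α := by linarith [h.one_lt]

theorem δ_le (h : ExpandingBranch α c₀ η v c φ D) : (α - 1) / (2 * α) ≤ 1 / 2 :=
  half_sub_one_div_le_half h.one_lt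

theorem std_mem (h : ExpandingBranch α c₀ η v c φ D) {x : ℝ} (hx : x ∈ Icc c 1) :
    stdBranch α v c x ∈ Icc (0 : ℝ) 1 := stdBranch_mem_Icc h.α_pos ⟨h.v_pos.le, h.v_le⟩ h.c_lt hx

theorem z_pos (h : ExpandingBranch α c₀ η v c φ D) {x : ℝ} (hx : c < x) :
    0 < (x - c) / (1 - c) := div_pos (by linarith) (by linarith [h.c_lt])

theorem hasDerivWithinAt (h : ExpandingBranch α c₀ η v c φ D) {x : ℝ} (hx : x ∈ Ioc c 1) :
    HasDerivWithinAt (fun y => φ (stdBranch α v c y)) (branchDeriv α v c D x) (Icc c 1) x :=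
  (h.near.hasDeriv _ (h.std_mem (Ioc_subset_Icc_self hx))).comp x
    (hasDerivAt_stdBranch h.c_lt hx.1).hasDerivWithinAt fun _ hy => h.std_mem hy

theorem hasDerivAt (h : ExpandingBranch α c₀ η v c φ D) {x : ℝ} (hx : x ∈ Ioo c 1) :
    HasDerivAt (fun y => φ (stdBranch α v c y)) (branchDeriv α v c D x) x :=
  (h.hasDerivWithinAt (Ioo_subset_Ioc_self hx)).hasDerivAt (Icc_mem_nhds hx.1 hx.2)

theorem continuousOn (h : ExpandingBranch α c₀ η v c φ D) :
    ContinuousOn (fun y => φ (stdBranch α v c y)) (Icc c 1) := by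
  refine ContinuousOn.comp (t := Icc 0 1)
    (fun x hx => (h.near.hasDeriv x hx).continuousWithinAt) ?_ fun _ hy => h.std_mem hy
  unfold stdBranch
  refine continuousOn_const.add (continuousOn_const.mul (continuousOn_const.add ?_))
  exact ((continuousOn_id.sub continuousOn_const).div_const _).rpow_const
    fun _ _ => Or.inr h.α_pos.le

theorem branchDeriv_pos (h : ExpandingBranch α c₀ η v c φ D) {x : ℝ} (hx : x ∈ Ioc c 1) :
    0 < branchDeriv α v c D x := by
  have h1 := h.near.half_le_deriv h.δ_le (h.std_mem (Ioc_subset_Icc_self hx))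
  have := h.α_pos
  have := h.v_pos
  have : 0 < 1 - c := by linarith [h.c_lt]
  have := Real.rpow_pos_of_pos (h.z_pos hx.1) (α - 1)
  have : 0 < D (stdBranch α v c x) := by linarith
  unfold branchDeriv
  positivity

/-- From `y` down to `x` the power factor of the derivative shrinks by `w ^ (α - 1)`, where `w` is
the ratio of the distances to `c`. Meanwhile `D` grows by at most `δ (1 - w ^ α)`. As `D ≥ 1/2` and
`2δ = (α - 1)/α`, the shrinking wins. -/
theorem branchDeriv_mono (h : ExpandingBranch α c₀ η v c φ D) {x y : ℝ} (hx : x ∈ Ioc c 1)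
    (hy : y ∈ Ioc c 1) (hxy : x ≤ y) : branchDeriv α v c D x ≤ branchDeriv α v c D y := by
  have hc : 0 < 1 - c := by linarith [h.c_lt]
  have hα := h.α_pos
  have hzx := h.z_pos hx.1
  have hzy := h.z_pos hy.1
  have hzy1 := (div_mem_Icc h.c_lt (Ioc_subset_Icc_self hy)).2
  have hzxy : (x - c) / (1 - c) ≤ (y - c) / (1 - c) := by gcongr
  have hqx := h.std_mem (Ioc_subset_Icc_self hx)
  have hqy := h.std_mem (Ioc_subset_Icc_self hy)
  have hqq := stdBranch_mono hα h.v_pos.le h.c_lt hx.1.le hxy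
  unfold branchDeriv
  have hdiff : stdBranch α v c y - stdBranch α v c x
      = v * (((y - c) / (1 - c)) ^ α - ((x - c) / (1 - c)) ^ α) := by unfold stdBranch; ring
  have hDx := h.near.half_le_deriv h.δ_le hqx
  have hlip := h.near.lip _ hqx _ hqy
  rw [abs_sub_comm (stdBranch α v c x), abs_of_nonneg (sub_nonneg.2 hqq)] at hlip
  generalize (x - c) / (1 - c) = zx at *
  generalize (y - c) / (1 - c) = zy at *
  obtain ⟨w, rfl⟩ : ∃ w, zx = w * zy := ⟨zx / zy, by field_simp⟩
  have hw0 : 0 < w := pos_of_mul_pos_left hzx hzy.le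
  have hw1 : w ≤ 1 := by
    by_contra! hcon
    nlinarith
  rw [Real.mul_rpow hw0.le hzy.le] at hdiff ⊢
  have hB := one_sub_rpow_sub_one_ge h.one_lt hw0.le
  have hwα : w ^ α ≤ 1 := Real.rpow_le_one hw0.le hw1 hα.le
  have hwα1 : w ^ (α - 1) ≤ 1 := Real.rpow_le_one hw0.le hw1 (by linarith [h.one_lt])
  have hzα : zy ^ α ≤ 1 := Real.rpow_le_one hzy.le hzy1 hα.le
  have hzα0 : 0 ≤ zy ^ α := Real.rpow_nonneg hzy.le α
  have hdiff' : stdBranch α v c y - stdBranch α v c x ≤ 1 - w ^ α := by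
    rw [hdiff]
    have h1 : v * (zy ^ α - w ^ α * zy ^ α) = (v * zy ^ α) * (1 - w ^ α) := by ring
    rw [h1]
    exact mul_le_of_le_one_left (by linarith) (mul_le_one₀ h.v_le hzα0 hzα)
  have hδ0 : 0 ≤ (α - 1) / (2 * α) := div_nonneg (by linarith [h.one_lt]) (by linarith)
  have hδ2 : (α - 1) / α = 2 * ((α - 1) / (2 * α)) := by field_simp
  have hkey : D (stdBranch α v c x) * w ^ (α - 1) ≤ D (stdBranch α v c y) := by
    have h1 := mul_le_mul_of_nonneg_left hdiff' hδ0
    have h2 : 1 / 2 * (1 - w ^ (α - 1)) ≤ D (stdBranch α v c x) * (1 - w ^ (α - 1)) :=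
      mul_le_mul_of_nonneg_right hDx (by linarith)
    rw [hδ2] at hB
    have h3 := (abs_le.1 hlip).2
    nlinarith
  have hA : 0 ≤ v * (α * zy ^ (α - 1) / (1 - c)) := by
    have := h.v_pos
    have := Real.rpow_nonneg hzy.le (α - 1)
    positivity
  calc D (stdBranch α v c x) * (v * (α * (w ^ (α - 1) * zy ^ (α - 1)) / (1 - c)))
      = D (stdBranch α v c x) * w ^ (α - 1) * (v * (α * zy ^ (α - 1) / (1 - c))) := by ring
    _ ≤ _ := mul_le_mul_of_nonneg_right hkey hA

theorem convexOn (h : ExpandingBranch α c₀ η v c φ D) :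
    ConvexOn ℝ (Icc c 1) fun y => φ (stdBranch α v c y) := by
  refine MonotoneOn.convexOn_of_deriv (convex_Icc c 1) h.continuousOn ?_ ?_
  · intro x hx
    rw [interior_Icc] at hx
    exact (h.hasDerivAt hx).differentiableAt.differentiableWithinAt
  · intro x hx y hy hxy
    rw [interior_Icc] at hx hy
    rw [(h.hasDerivAt hx).deriv, (h.hasDerivAt hy).deriv]
    exact h.branchDeriv_mono (Ioo_subset_Ioc_self hx) (Ioo_subset_Ioc_self hy) hxy

theorem map_one (h : ExpandingBranch α c₀ η v c φ D) : φ (stdBranch α v c 1) = 1 := by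
  rw [stdBranch_one h.c_lt, h.near.map_one]

/-- The branch moves points away from its fixed point `1` at a definite rate. -/
theorem expand_one (h : ExpandingBranch α c₀ η v c φ D) {x : ℝ} (hx : x ∈ Icc c 1) :
    (1 + η) * (1 - x) ≤ 1 - φ (stdBranch α v c x) := by
  have hc : 0 < 1 - c := by linarith [h.c_lt]
  have hη := h.η_pos
  -- The graph lies below the chord over `[c, 1]`, whose slope is at least `(1 - c + η)/(1 - c) ≥ 1
  -- + η`.
  have h1 := h.convexOn.2 (left_mem_Icc.2 h.c_lt.le) (right_mem_Icc.2 h.c_lt.le)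
    (show 0 ≤ (1 - x) / (1 - c) from div_nonneg (by linarith [hx.2]) hc.le)
    (show 0 ≤ (x - c) / (1 - c) from div_nonneg (by linarith [hx.1]) hc.le) (by field_simp; ring)
  have e : (1 - x) / (1 - c) * c + (x - c) / (1 - c) * 1 = x := by
    field_simp; ring
  simp only [smul_eq_mul, e, h.map_one, stdBranch_crit h.α_pos] at h1
  have h2 : (1 - x) / (1 - c) * φ (1 - v) ≤ (1 - x) / (1 - c) * (c - η) :=
    mul_le_mul_of_nonneg_left h.crit (div_nonneg (by linarith [hx.2]) hc.le)
  have h3 : (1 - x) / (1 - c) * (c - η) + (x - c) / (1 - c) * 1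
      = 1 - (1 - x) - η * ((1 - x) / (1 - c)) := by field_simp; ring
  have h4 : 1 - x ≤ (1 - x) / (1 - c) := by
    rw [le_div_iff₀ hc]
    nlinarith [hx.2, h.c_nonneg]
  nlinarith

/-- Points which are mapped close to `c` or to the right of it are bounded away from `c`. -/
theorem le_of_le_map (h : ExpandingBranch α c₀ η v c φ D) {x p : ℝ} (hx : x ∈ Icc c 1)
    (hp : c - η / 2 ≤ p) (hpx : p ≤ φ (stdBranch α v c x)) :
    (η / 4) ^ (1 / α) ≤ (x - c) / (1 - c) := by
  have hz := div_mem_Icc h.c_lt hx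
  have hc := stdBranch_crit (v := v) (c := c) h.α_pos
  have h1 := h.near.sub_le h.δ_le (x := stdBranch α v c c) (y := stdBranch α v c x)
    (h.std_mem (left_mem_Icc.2 h.c_lt.le)).1
    (stdBranch_mono h.α_pos h.v_pos.le h.c_lt le_rfl hx.1) (h.std_mem hx).2
  rw [hc] at h1
  have h2 : stdBranch α v c x - (1 - v) = v * ((x - c) / (1 - c)) ^ α := by unfold stdBranch; ring
  rw [h2] at h1
  have h3 : v * ((x - c) / (1 - c)) ^ α ≤ ((x - c) / (1 - c)) ^ α :=
    mul_le_of_le_one_left (Real.rpow_nonneg hz.1 α) h.v_le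
  have h4 : η / 4 ≤ ((x - c) / (1 - c)) ^ α := by linarith [h.crit]
  have h5 := Real.rpow_le_rpow (by linarith [h.η_pos]) h4 (z := 1 / α)
    (one_div_nonneg.2 h.α_pos.le)
  rwa [← Real.rpow_mul hz.1, mul_one_div_cancel h.α_pos.ne', Real.rpow_one] at h5

/-- In the variable `z = (x - c)/(1 - c)` the logarithm is `log D`, which is `α`-Lipschitz in `z`,
plus a constant, plus `(α - 1) log z`, which is `(α - 1)/z₀`-Lipschitz for `z ≥ z₀`. Passing from
`z` to `x` costs `1/c₀`. -/
theorem abs_log_branchDeriv_sub_le (h : ExpandingBranch α c₀ η v c φ D) {x y z₀ : ℝ} (hz₀ : 0 < z₀)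
    (hx : x ≤ 1) (hy : y ≤ 1) (hzx : z₀ ≤ (x - c) / (1 - c)) (hzy : z₀ ≤ (y - c) / (1 - c)) :
    |Real.log (branchDeriv α v c D x) - Real.log (branchDeriv α v c D y)|
      ≤ (α + (α - 1) / z₀) / c₀ * |x - y| := by
  wlog hxy : x ≤ y generalizing x y
  · rw [abs_sub_comm, abs_sub_comm x y]
    exact this hy hx hzy hzx (le_of_not_ge hxy)
  have hc : 0 < 1 - c := by linarith [h.c_lt]
  have hα := h.α_pos
  have hv := h.v_pos
  have hpos : ∀ w, z₀ ≤ (w - c) / (1 - c) → c < w := fun w hw => by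
    rw [le_div_iff₀ hc] at hw
    nlinarith
  have hx' : x ∈ Ioc c 1 := ⟨hpos x hzx, hx⟩
  have hy' : y ∈ Ioc c 1 := ⟨hpos y hzy, hy⟩
  have hqx := h.std_mem (Ioc_subset_Icc_self hx')
  have hqy := h.std_mem (Ioc_subset_Icc_self hy')
  have hlog : ∀ w ∈ Ioc c 1, Real.log (branchDeriv α v c D w)
      = Real.log (D (stdBranch α v c w)) + Real.log (v * α / (1 - c))
        + (α - 1) * Real.log ((w - c) / (1 - c)) := fun w hw => by
    have h1 := h.near.half_le_deriv h.δ_le (h.std_mem (Ioc_subset_Icc_self hw))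
    have h2 := h.z_pos hw.1
    unfold branchDeriv
    rw [show v * (α * ((w - c) / (1 - c)) ^ (α - 1) / (1 - c))
      = v * α / (1 - c) * ((w - c) / (1 - c)) ^ (α - 1) by ring,
      Real.log_mul (by linarith) (by positivity), Real.log_mul (by positivity) (by positivity),
      Real.log_rpow h2]
    ring
  have hzd : |(x - c) / (1 - c) - (y - c) / (1 - c)| ≤ |x - y| / c₀ := by
    rw [← sub_div, abs_div, abs_of_pos hc, show x - c - (y - c) = x - y by ring]
    exact div_le_div_of_nonneg_left (abs_nonneg _) h.c₀_pos h.c₀_le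
  have hq : |stdBranch α v c x - stdBranch α v c y|
      ≤ α * |(x - c) / (1 - c) - (y - c) / (1 - c)| := by
    have hzy1 := (div_mem_Icc h.c_lt (Ioc_subset_Icc_self hy')).2
    have hzxy : (x - c) / (1 - c) ≤ (y - c) / (1 - c) := by gcongr
    have hqq := stdBranch_mono hα hv.le h.c_lt hx'.1.le hxy
    rw [abs_sub_comm, abs_of_nonneg (sub_nonneg.2 hqq), abs_sub_comm,
      abs_of_nonneg (sub_nonneg.2 hzxy)]
    have e : stdBranch α v c y - stdBranch α v c x
      = v * (((y - c) / (1 - c)) ^ α - ((x - c) / (1 - c)) ^ α) := by unfold stdBranch; ring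
    rw [e]
    have hzx0 := h.z_pos hx'.1
    have hzy0 := h.z_pos hy'.1
    generalize (x - c) / (1 - c) = zx at *
    generalize (y - c) / (1 - c) = zy at *
    have hle : zx ^ α ≤ zy ^ α := Real.rpow_le_rpow hzx0.le hzxy hα.le
    have hlip : zy ^ α - zx ^ α ≤ α * (zy - zx) := by
      have hB := one_add_mul_self_le_rpow_one_add (s := zx / zy - 1)
        (by linarith [div_pos hzx0 hzy0]) h.one_lt.le
      rw [show 1 + (zx / zy - 1) = zx / zy by ring, Real.div_rpow hzx0.le hzy0.le] at hB
      have hp := Real.rpow_pos_of_pos hzy0 α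
      rw [le_div_iff₀ hp] at hB
      have e2 : zy ^ α = zy * zy ^ (α - 1) := by
        rw [mul_comm, ← Real.rpow_add_one hzy0.ne']; congr 1; ring
      have h5 : zy ^ (α - 1) ≤ 1 := Real.rpow_le_one hzy0.le hzy1 (by linarith [h.one_lt])
      have e3 : (1 + α * (zx / zy - 1)) * zy ^ α
          = zy ^ α - α * ((zy - zx) * zy ^ (α - 1)) := by
        rw [e2]; field_simp; ring
      rw [e3] at hB
      have h6 : (zy - zx) * zy ^ (α - 1) ≤ zy - zx :=
        mul_le_of_le_one_right (by linarith) h5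
      nlinarith
    have := h.v_le
    nlinarith
  have hD := h.near.abs_log_deriv_sub_le h.δ_le hqx hqy
  have hz := abs_log_sub_log_le hz₀ hzx hzy
  rw [hlog x hx', hlog y hy']
  calc _ = |(Real.log (D (stdBranch α v c x)) - Real.log (D (stdBranch α v c y)))
          + (α - 1) * (Real.log ((x - c) / (1 - c)) - Real.log ((y - c) / (1 - c)))| := by
        congr 1; ring
    _ ≤ α * |(x - c) / (1 - c) - (y - c) / (1 - c)|
        + (α - 1) * (|(x - c) / (1 - c) - (y - c) / (1 - c)| / z₀) := by
        refine (abs_add_le _ _).trans (add_le_add (hD.trans hq) ?_)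
        have : 0 ≤ α - 1 := by linarith [h.one_lt]
        rw [abs_mul, abs_of_nonneg this]
        gcongr
    _ = (α + (α - 1) / z₀) * |(x - c) / (1 - c) - (y - c) / (1 - c)| := by ring
    _ ≤ (α + (α - 1) / z₀) * (|x - y| / c₀) := by
        have : 0 ≤ α - 1 := by linarith [h.one_lt]
        gcongr
    _ = _ := by ring

/-- Uniform expansion near the fixed point `1`. -/
theorem expand (h : ExpandingBranch α c₀ η v c φ D) {x y z₀ ρ : ℝ} (hz₀ : 0 < z₀)
    (hx : x ≤ 1) (hy : y ≤ 1) (hzx : z₀ ≤ (x - c) / (1 - c)) (hzy : z₀ ≤ (y - c) / (1 - c))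
    (hxρ : 1 - x ≤ ρ) (hyρ : 1 - y ≤ ρ) :
    |x - y| ≤ (1 + η)⁻¹ * Real.exp ((α + (α - 1) / z₀) / c₀ * ρ)
      * |φ (stdBranch α v c x) - φ (stdBranch α v c y)| := by
  wlog hxy : x < y generalizing x y
  · rcases (not_lt.1 hxy).eq_or_lt with rfl | hlt
    · simp
    · rw [abs_sub_comm, abs_sub_comm (φ _)]
      exact this hy hx hzy hzx hyρ hxρ hlt
  have hc : 0 < 1 - c := by linarith [h.c_lt]
  have hη := h.η_pos
  set L := (α + (α - 1) / z₀) / c₀ with hL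
  have hL0 : 0 ≤ L := by
    have := h.c₀_pos
    have := h.α_pos
    have : 0 ≤ α - 1 := by linarith [h.one_lt]
    positivity
  have hcx : c < x := by
    rw [le_div_iff₀ hc] at hzx
    nlinarith
  have mvt : ∀ a b, x ≤ a → a < b → b ≤ 1 → ∃ m ∈ Ioo a b,
      φ (stdBranch α v c b) - φ (stdBranch α v c a) = branchDeriv α v c D m * (b - a) := by
    intro a b hxa hab hb
    have hs : Icc a b ⊆ Icc c 1 := Icc_subset_Icc (hcx.le.trans hxa) hb
    obtain ⟨m, hm, hm'⟩ := exists_hasDerivAt_eq_slope (fun y => φ (stdBranch α v c y))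
      (branchDeriv α v c D) hab (h.continuousOn.mono hs)
      (fun w hw => h.hasDerivAt ⟨(hcx.trans_le hxa).trans hw.1, hw.2.trans_le hb⟩)
    exact ⟨m, hm, by rw [hm', div_mul_cancel₀ _ (sub_pos.2 hab).ne']⟩
  obtain ⟨m, hm, hm'⟩ := mvt x y le_rfl hxy hy
  have hm1 : m < 1 := hm.2.trans_le hy
  obtain ⟨n, hn, hn'⟩ := mvt m 1 hm.1.le hm1 le_rfl
  have hzw : ∀ w, x ≤ w → z₀ ≤ (w - c) / (1 - c) := fun w hw => hzx.trans (by gcongr)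
  have hmI : m ∈ Ioc c 1 := ⟨hcx.trans hm.1, hm1.le⟩
  have hnI : n ∈ Ioc c 1 := ⟨hmI.1.trans hn.1, hn.2.le⟩
  have hmp := h.branchDeriv_pos hmI
  have hnp := h.branchDeriv_pos hnI
  -- `n` is a mean value point between `m` and the fixed point `1`, where `expand_one` bounds the
  -- slope from below. By convexity the derivative at `m` is no larger than at `n`, so the bound
  -- must be carried back to `m` by distortion, at the cost of the exponential factor.
  have h1 : 1 + η ≤ branchDeriv α v c D n := by
    have := h.expand_one (Ioc_subset_Icc_self hmI)
    rw [h.map_one] at hn'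
    rw [hn'] at this
    exact le_of_mul_le_mul_right this (sub_pos.2 hm1)
  have h2 := h.abs_log_branchDeriv_sub_le hz₀ hn.2.le hm1.le (hzw n (hm.1.trans hn.1).le)
    (hzw m hm.1.le)
  rw [abs_of_pos (sub_pos.2 hn.1), ← hL] at h2
  have h3 : L * (n - m) ≤ L * ρ :=
    mul_le_mul_of_nonneg_left (by linarith [hn.2, hm.1]) hL0
  have h4 : branchDeriv α v c D n ≤ Real.exp (L * ρ) * branchDeriv α v c D m := by
    rw [← Real.exp_log hnp, ← Real.exp_log hmp, ← Real.exp_add, Real.exp_le_exp]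
    linarith [(abs_le.1 h2).2]
  rw [abs_sub_comm, abs_of_pos (sub_pos.2 hxy), abs_sub_comm, hm', abs_of_pos
    (mul_pos hmp (sub_pos.2 hxy)), ← mul_assoc]
  refine le_mul_of_one_le_left (sub_pos.2 hxy).le ?_
  rw [mul_assoc, ← div_eq_inv_mul, le_div_iff₀ (by linarith), one_mul]
  exact h1.trans h4

end ExpandingBranch

/-! ### Long orbits under one branch -/

/-- A lower bound for the rescaled distance to the critical point along orbits entering `C`. -/
noncomputable def orbitMargin (α η : ℝ) : ℝ := (η / 4) ^ (1 / α)

/-- A Lipschitz constant for the logarithm of the derivative along orbits entering `C`. -/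
noncomputable def logDerivLip (α c₀ η : ℝ) : ℝ := (α + (α - 1) / orbitMargin α η) / c₀

/-- A bound for the total length of an orbit of intervals relative to its last interval. -/
noncomputable def orbitConst (α c₀ η : ℝ) : ℝ :=
  Real.exp (logDerivLip α c₀ η / (1 - (1 + η)⁻¹)) / (1 - (1 + η)⁻¹)

theorem orbitMargin_pos {α η : ℝ} (hη : 0 < η) : 0 < orbitMargin α η :=
  Real.rpow_pos_of_pos (by linarith) _

namespace ExpandingBranch

variable {α c₀ η v c : ℝ} {φ D : ℝ → ℝ}

theorem η_le (h : ExpandingBranch α c₀ η v c φ D) : η ≤ c := by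
  have := (h.near.mem_Icc h.δ_le (x := 1 - v) ⟨by linarith [h.v_le], by linarith [h.v_pos]⟩).1
  linarith [h.crit]

theorem inv_mem (h : ExpandingBranch α c₀ η v c φ D) : (1 + η)⁻¹ ∈ Ioo (0 : ℝ) 1 :=
  ⟨inv_pos.2 (by linarith [h.η_pos]), inv_lt_one_of_one_lt₀ (by linarith [h.η_pos])⟩

theorem one_sub_le_mul (h : ExpandingBranch α c₀ η v c φ D) {x : ℝ} (hx : x ∈ Icc c 1) :
    1 - x ≤ (1 + η)⁻¹ * (1 - φ (stdBranch α v c x)) := by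
  rw [← div_eq_inv_mul, le_div_iff₀ (by linarith [h.η_pos]), mul_comm]
  exact h.expand_one hx

theorem one_sub_le_pow (h : ExpandingBranch α c₀ η v c φ D) {X : ℕ → ℝ} {n : ℕ}
    (hX : ∀ k < n, X k ∈ Icc c 1) (hX' : ∀ k < n, X (k + 1) = φ (stdBranch α v c (X k)))
    (hn : 0 ≤ X n) : 1 - X 0 ≤ (1 + η)⁻¹ ^ n := by
  induction n generalizing X with
  | zero => simpa using hn
  | succ n ih =>
    have h1 := ih (X := fun k => X (k + 1)) (fun k hk => hX _ (by omega))
      (fun k hk => hX' _ (by omega)) hn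
    have h2 := h.one_sub_le_mul (hX 0 (by omega))
    rw [← hX' 0 (by omega)] at h2
    rw [pow_succ']
    exact h2.trans (mul_le_mul_of_nonneg_left h1 h.inv_mem.1.le)

/-- Orbits entering a neighbourhood of `C` stay away from the critical point until then. -/
theorem orbitMargin_le (h : ExpandingBranch α c₀ η v c φ D) {X : ℕ → ℝ} {a : ℕ}
    (hX : ∀ k < a, X k ∈ Icc c 1) (hX' : ∀ k < a, X (k + 1) = φ (stdBranch α v c (X k)))
    (hXa : c - η / 2 ≤ X a) {k : ℕ} (hk : k < a) : orbitMargin α η ≤ (X k - c) / (1 - c) := by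
  refine h.le_of_le_map (hX k hk) le_rfl ?_
  rw [← hX' k hk]
  -- The next point is either the final one, at least `c - η/2` by hypothesis, or still to the right
  -- of `c`.
  rcases (Nat.succ_le_of_lt hk).eq_or_lt with e | hlt
  · rw [← Nat.succ_eq_add_one, e]; exact hXa
  · exact le_trans (by linarith [h.η_pos]) (hX (k + 1) hlt).1

theorem sum_orbit_le (h : ExpandingBranch α c₀ η v c φ D) {X Y : ℕ → ℝ} {a : ℕ}
    (hX : ∀ k < a, X k ∈ Icc c 1) (hX' : ∀ k < a, X (k + 1) = φ (stdBranch α v c (X k)))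
    (hXa : c - η / 2 ≤ X a)
    (hY : ∀ k < a, Y k ∈ Icc c 1) (hY' : ∀ k < a, Y (k + 1) = φ (stdBranch α v c (Y k)))
    (hYa : c - η / 2 ≤ Y a) :
    ∑ k ∈ Finset.range a, |X k - Y k| ≤ orbitConst α c₀ η * |X a - Y a| := by
  have hη := h.η_pos
  have hz₀ := orbitMargin_pos (α := α) hη
  have hL : 0 ≤ logDerivLip α c₀ η := by
    have := h.c₀_pos
    have := h.α_pos
    have : 0 ≤ α - 1 := by linarith [h.one_lt]
    unfold logDerivLip
    positivity
  -- Time runs backwards from the last point: inverse branches contract by `(1 + η)⁻¹` up to an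
  -- error governed by `e`, the distance to the fixed point `1`. Initially `e ≤ 1` because `η ≤ c`
  -- makes the last points nonnegative.
  have key := sum_dist_le_of_contracting h.inv_mem.1 h.inv_mem.2 hL (n := a)
    (d := fun j => |X (a - j) - Y (a - j)|) (e := fun j => max (1 - X (a - j)) (1 - Y (a - j)))
    (fun j => abs_nonneg _)
    (by have := h.η_le; simp only [Nat.sub_zero]; exact max_le (by linarith) (by linarith))
    (fun j hj => by
      have e : a - j = a - (j + 1) + 1 := by omega
      have hk : a - (j + 1) < a := by omega
      simp only [e]
      rw [mul_max_of_nonneg _ _ h.inv_mem.1.le, hX' _ hk, hY' _ hk]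
      exact max_le_max (h.one_sub_le_mul (hX _ hk)) (h.one_sub_le_mul (hY _ hk)))
    (fun j hj => by
      have e : a - j = a - (j + 1) + 1 := by omega
      have hk : a - (j + 1) < a := by omega
      simp only [e]
      rw [hX' _ hk, hY' _ hk]
      exact h.expand hz₀ (hX _ hk).2 (hY _ hk).2 (h.orbitMargin_le hX hX' hXa hk)
        (h.orbitMargin_le hY hY' hYa hk) (le_max_left _ _) (le_max_right _ _))
  rw [← Finset.sum_range_reflect]
  refine le_trans (le_of_eq (Finset.sum_congr rfl fun j _ => ?_)) key
  simp only [show a - 1 - j = a - (j + 1) by omega]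

/-- The logarithmic variation of the derivative of a rescaled long composition of branches. -/
theorem abs_log_deriv_sub_le (h : ExpandingBranch α c₀ η v c φ D) {δ s t p q : ℝ} {a : ℕ}
    {ψ Dψ G DG : ℝ → ℝ} {X : ℕ → ℝ → ℝ} (hψ : NearIdentity δ ψ Dψ) (hδ : δ ≤ 1 / 2)
    (hs : 0 ≤ s) (hst : s < t) (ht : t ≤ 1) (hpq : p < q) (hp : c - η / 2 ≤ p)
    (hG : ∀ y ∈ Icc (0 : ℝ) 1, HasDerivWithinAt G (DG y) (Icc 0 1) y)
    (hG0 : ∀ y ∈ Icc (0 : ℝ) 1, 0 ≤ G y) (hDG : ∀ y ∈ Icc (0 : ℝ) 1, 0 < DG y)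
    (hX0 : ∀ y ∈ Icc (0 : ℝ) 1, X 0 y = ψ (s + (t - s) * y))
    (hX : ∀ k < a, ∀ y ∈ Icc (0 : ℝ) 1, c < X k y)
    (hX' : ∀ k < a, ∀ y ∈ Icc (0 : ℝ) 1, X (k + 1) y = φ (stdBranch α v c (X k y)))
    (hXa : ∀ y ∈ Icc (0 : ℝ) 1, X a y = p + (q - p) * G y)
    {y y' : ℝ} (hy : y ∈ Icc (0 : ℝ) 1) (hy' : y' ∈ Icc (0 : ℝ) 1) :
    |Real.log (DG y) - Real.log (DG y')| ≤ (t - s) * |y - y'|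
      + logDerivLip α c₀ η * orbitConst α c₀ η * (q - p) * |G y - G y'| := by
  have hts : 0 < t - s := sub_pos.2 hst
  have hqp : 0 < q - p := sub_pos.2 hpq
  have hz₀ := orbitMargin_pos (α := α) h.η_pos
  have hσ : ∀ y ∈ Icc (0 : ℝ) 1, s + (t - s) * y ∈ Icc (0 : ℝ) 1 := fun y hy =>
    ⟨by nlinarith [hy.1], by nlinarith [hy.2]⟩
  have hX1 : ∀ k < a, ∀ y ∈ Icc (0 : ℝ) 1, X k y ∈ Ioc c 1 := by
    intro k
    induction k with
    | zero => exact fun hk y hy => ⟨hX 0 hk y hy, by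
        rw [hX0 y hy]; exact (hψ.mem_Icc hδ (hσ y hy)).2⟩
    | succ k ih => exact fun hk y hy => ⟨hX _ hk y hy, by
        rw [hX' k (by omega) y hy]
        exact (h.near.mem_Icc h.δ_le (h.std_mem (Ioc_subset_Icc_self (ih (by omega) y hy)))).2⟩
  have hder : ∀ k ≤ a, ∀ y ∈ Icc (0 : ℝ) 1, HasDerivWithinAt (X k)
      (Dψ (s + (t - s) * y) * (t - s) * ∏ j ∈ Finset.range k, branchDeriv α v c D (X j y))
      (Icc 0 1) y := by
    intro k
    induction k with
    | zero =>
      intro _ y hy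
      have h1 : HasDerivWithinAt (fun y : ℝ => s + (t - s) * y) (t - s) (Icc 0 1) y := by
        simpa using (((hasDerivWithinAt_id y (Icc (0 : ℝ) 1)).const_mul (t - s)).const_add s)
      have h2 := (hψ.hasDeriv _ (hσ y hy)).comp y h1 hσ
      rw [Finset.range_zero, Finset.prod_empty, mul_one]
      exact h2.congr (fun w hw => hX0 w hw) (hX0 y hy)
    | succ k ih =>
      intro hk y hy
      have h2 := (h.hasDerivWithinAt (hX1 k hk y hy)).comp y (ih (by omega) y hy)
        (fun w hw => Ioc_subset_Icc_self (hX1 k hk w hw))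
      rw [Finset.prod_range_succ, ← mul_assoc, mul_comm]
      exact h2.congr (fun w hw => hX' k hk w hw) (hX' k hk y hy)
  have hlog : ∀ y ∈ Icc (0 : ℝ) 1, Real.log (DG y) = Real.log (Dψ (s + (t - s) * y))
      + Real.log (t - s) - Real.log (q - p)
      + ∑ j ∈ Finset.range a, Real.log (branchDeriv α v c D (X j y)) := fun y hy => by
    have h1 : HasDerivWithinAt (X a) ((q - p) * DG y) (Icc 0 1) y :=
      (((hG y hy).const_mul (q - p)).const_add p).congr hXa (hXa y hy)
    -- The derivative of `X a` is computed twice, by the chain rule and from the rescaled map `G`.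
    -- The constants `log (t - s)` and `log (q - p)` cancel in differences.
    have h2 := (uniqueDiffOn_Icc zero_lt_one y hy).eq_deriv _ h1 (hder a le_rfl y hy)
    have h3 := congrArg Real.log h2
    have hb : ∀ j ∈ Finset.range a, branchDeriv α v c D (X j y) ≠ 0 := fun j hj =>
      (h.branchDeriv_pos (hX1 j (Finset.mem_range.1 hj) y hy)).ne'
    have hd : Dψ (s + (t - s) * y) ≠ 0 :=
      (by linarith [hψ.half_le_deriv hδ (hσ y hy)] : 0 < Dψ (s + (t - s) * y)).ne'
    rw [Real.log_mul hqp.ne' (hDG y hy).ne', Real.log_mul (mul_ne_zero hd hts.ne')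
      (Finset.prod_ne_zero_iff.2 hb), Real.log_mul hd hts.ne', Real.log_prod hb] at h3
    linarith
  have hend : ∀ y ∈ Icc (0 : ℝ) 1, c - η / 2 ≤ X a y := fun y hy => by
    rw [hXa y hy]
    have := mul_nonneg hqp.le (hG0 y hy)
    linarith
  have hmar : ∀ y ∈ Icc (0 : ℝ) 1, ∀ k < a, orbitMargin α η ≤ (X k y - c) / (1 - c) :=
    fun y hy k hk => h.orbitMargin_le (X := fun k => X k y)
      (fun k hk => Ioc_subset_Icc_self (hX1 k hk y hy)) (fun k hk => hX' k hk y hy) (hend y hy) hk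
  have hsum := h.sum_orbit_le (X := fun k => X k y) (Y := fun k => X k y') (a := a)
    (fun k hk => Ioc_subset_Icc_self (hX1 k hk y hy)) (fun k hk => hX' k hk y hy) (hend y hy)
    (fun k hk => Ioc_subset_Icc_self (hX1 k hk y' hy')) (fun k hk => hX' k hk y' hy') (hend y' hy')
  have hL : 0 ≤ logDerivLip α c₀ η := by
    have := h.c₀_pos
    have := h.α_pos
    have : 0 ≤ α - 1 := by linarith [h.one_lt]
    unfold logDerivLip
    positivity
  have hψ' := hψ.abs_log_deriv_sub_le hδ (hσ y hy) (hσ y' hy')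
  rw [show s + (t - s) * y - (s + (t - s) * y') = (t - s) * (y - y') by ring, abs_mul,
    abs_of_pos hts] at hψ'
  have hXX : |X a y - X a y'| = (q - p) * |G y - G y'| := by
    rw [hXa y hy, hXa y' hy', show p + (q - p) * G y - (p + (q - p) * G y')
      = (q - p) * (G y - G y') by ring, abs_mul, abs_of_pos hqp]
  rw [hlog y hy, hlog y' hy']
  calc _ = |(Real.log (Dψ (s + (t - s) * y)) - Real.log (Dψ (s + (t - s) * y')))
        + ∑ j ∈ Finset.range a, (Real.log (branchDeriv α v c D (X j y))
          - Real.log (branchDeriv α v c D (X j y')))| := by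
        rw [Finset.sum_sub_distrib]; congr 1; ring
    _ ≤ (t - s) * |y - y'| + ∑ j ∈ Finset.range a, logDerivLip α c₀ η * |X j y - X j y'| := by
        refine (abs_add_le _ _).trans (add_le_add hψ' ?_)
        refine (Finset.abs_sum_le_sum_abs _ _).trans (Finset.sum_le_sum fun j hj => ?_)
        have hj := Finset.mem_range.1 hj
        exact h.abs_log_branchDeriv_sub_le hz₀ (hX1 j hj y hy).2 (hX1 j hj y' hy').2
          (hmar y hy j hj) (hmar y' hy' j hj)
    _ ≤ (t - s) * |y - y'| + logDerivLip α c₀ η * (orbitConst α c₀ η * |X a y - X a y'|) := by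
        rw [← Finset.mul_sum]
        exact add_le_add le_rfl (mul_le_mul_of_nonneg_left hsum hL)
    _ = _ := by rw [hXX]; ring

end ExpandingBranch

/-! ### Distance of the critical values from the critical point -/

theorem le_rpow_one_div {α w B : ℝ} (hα : 0 < α) (hw : 0 ≤ w) (h : w ^ α ≤ B) :
    w ≤ B ^ (1 / α) := by
  have := Real.rpow_le_rpow (Real.rpow_nonneg hw α) h (one_div_nonneg.2 hα.le)
  rwa [← Real.rpow_mul hw, mul_one_div_cancel hα.ne', Real.rpow_one] at this

/-- A lower bound for the distance of both critical values to the critical point. -/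
noncomputable def critMargin (α c₀ : ℝ) : ℝ := (4 / (c₀ ^ 2) ^ α)⁻¹ ^ (1 / (α - 1))

theorem critMargin_pos {α c₀ : ℝ} (hc₀ : 0 < c₀) : 0 < critMargin α c₀ := by
  unfold critMargin; positivity

/-- Neither inequality alone excludes small values, but their product is `xy ≤ B (xy) ^ α` with `B =
4 / (c₀ ^ 2) ^ α`. Dividing by `xy` bounds it below, and `x ≥ xy` since `y ≤ 1`. -/
theorem critMargin_le {α c₀ x y : ℝ} (hα : 1 < α) (hc₀ : 0 < c₀) (hx : 0 < x) (hy : 0 < y)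
    (hy1 : y ≤ 1) (hxy : x ≤ 2 * (y / c₀) ^ α) (hyx : y ≤ 2 * (x / c₀) ^ α) :
    critMargin α c₀ ≤ x := by
  have hw : 0 < x * y := mul_pos hx hy
  have hB : 0 < 4 / (c₀ ^ 2) ^ α := by positivity
  have h1 : x * y ≤ 4 / (c₀ ^ 2) ^ α * (x * y) ^ α := by
    calc x * y ≤ 2 * (y / c₀) ^ α * (2 * (x / c₀) ^ α) := by gcongr
      _ = 4 * (x / c₀ * (y / c₀)) ^ α := by
        rw [Real.mul_rpow (by positivity) (by positivity)]; ring
      _ = 4 * (x * y / c₀ ^ 2) ^ α := by congr 2; field_simp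
      _ = _ := by rw [Real.div_rpow hw.le (by positivity)]; ring
  have h2 : (4 / (c₀ ^ 2) ^ α)⁻¹ ≤ (x * y) ^ (α - 1) := by
    rw [inv_le_iff_one_le_mul₀' hB]
    have e : (x * y) ^ α = (x * y) ^ (α - 1) * (x * y) := by
      rw [← Real.rpow_add_one hw.ne']; congr 1; ring
    rw [e, ← mul_assoc] at h1
    exact le_of_mul_le_mul_right (by simpa using h1) hw
  have h3 := Real.rpow_le_rpow (by positivity) h2 (z := 1 / (α - 1))
    (one_div_nonneg.2 (by linarith))
  rw [← Real.rpow_mul hw.le, mul_one_div_cancel (by linarith), Real.rpow_one] at h3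
  exact h3.trans (mul_le_of_le_one_right hx.le hy1)

theorem NearIdentity.branch_sub_crit_le {δ α c₀ v c x : ℝ} {φ D : ℝ → ℝ}
    (h : NearIdentity δ φ D) (hδ : δ ≤ 1 / 2) (hα : 0 < α) (hc₀ : 0 < c₀) (hc : c₀ ≤ 1 - c)
    (hv : v ∈ Icc (0 : ℝ) 1) (hx : x ∈ Icc c 1) :
    φ (stdBranch α v c x) - φ (1 - v) ≤ 2 * ((x - c) / c₀) ^ α := by
  have hc1 : c < 1 := by linarith
  have hz := div_mem_Icc hc1 hx
  have h1 := h.sub_le hδ (x := 1 - v) (y := stdBranch α v c x) (by linarith [hv.2])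
    (by rw [← stdBranch_crit hα (c := c)]; exact stdBranch_mono hα hv.1 hc1 le_rfl hx.1)
    (stdBranch_mem_Icc hα hv hc1 hx).2
  have h2 : stdBranch α v c x - (1 - v) = v * ((x - c) / (1 - c)) ^ α := by unfold stdBranch; ring
  have h3 : v * ((x - c) / (1 - c)) ^ α ≤ ((x - c) / (1 - c)) ^ α :=
    mul_le_of_le_one_left (Real.rpow_nonneg hz.1 α) hv.2
  have h4 : ((x - c) / (1 - c)) ^ α ≤ ((x - c) / c₀) ^ α :=
    Real.rpow_le_rpow hz.1 (div_le_div_of_nonneg_left (by linarith [hx.1]) hc₀ hc) hα.le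
  linarith

/-- The exponent is `a - 1` because `X (a - 1)` is the last point known to be to the right of `c`.
The factor `2` comes from undoing `ψ`, whose slope is at least `1/2`. -/
theorem ExpandingBranch.one_sub_le_of_orbit {α c₀ η v c δ y : ℝ} {φ D ψ Dψ : ℝ → ℝ} {X : ℕ → ℝ}
    {a : ℕ} (h : ExpandingBranch α c₀ η v c φ D) (hψ : NearIdentity δ ψ Dψ) (hδ : δ ≤ 1 / 2)
    (ha : 1 ≤ a) (hy : y ∈ Icc (0 : ℝ) 1) (hX0 : X 0 = ψ y) (hX : ∀ k < a, X k ∈ Icc c 1)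
    (hX' : ∀ k < a, X (k + 1) = φ (stdBranch α v c (X k))) :
    1 - y ≤ 2 * (1 + η)⁻¹ ^ (a - 1) := by
  have h1 := h.one_sub_le_pow (n := a - 1) (fun k hk => hX k (by omega))
    (fun k hk => hX' k (by omega)) (h.c_nonneg.trans (hX _ (by omega)).1)
  have h2 := hψ.le_sub hδ hy.1 hy.2 le_rfl
  rw [hψ.map_one, ← hX0] at h2
  linarith

namespace LorenzMap

variable {α : ℝ} {f : LorenzMap α}

theorem map_of_le {x : ℝ} (hx : f.c ≤ x) :
    f.map x = f.phiPlus.toFun (stdBranch α f.v f.c x) := by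
  simp [map, std, standardLorenz, stdBranch, not_lt.2 hx]

theorem std_of_lt {x : ℝ} (hx : x < f.c) :
    f.std x = 1 - stdBranch α f.u (1 - f.c) (1 - x) := by
  simp only [std, standardLorenz, stdBranch, if_pos hx, sub_sub_cancel,
    show 1 - x - (1 - f.c) = f.c - x by ring]
  ring

/-- The left branch becomes a right branch after conjugation by `x ↦ 1 - x`. -/
theorem one_sub_map_of_lt {x : ℝ} (hx : x < f.c) :
    1 - f.map x = 1 - f.phiMinus.toFun (1 - stdBranch α f.u (1 - f.c) (1 - x)) := by
  rw [map, if_pos hx, std_of_lt hx]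

theorem map_mem_Icc (hα : 0 < α) {x : ℝ} (hx : x ∈ Icc (0 : ℝ) 1) : f.map x ∈ Icc (0 : ℝ) 1 := by
  rcases lt_or_ge x f.c with hlt | hle
  · rw [map, if_pos hlt, std_of_lt hlt]
    have := stdBranch_mem_Icc hα f.u_mem (show 1 - f.c < 1 by linarith [f.c_mem.1])
      (x := 1 - x) ⟨by linarith, by linarith [hx.1]⟩
    exact f.phiMinus.mem_Icc ⟨by linarith [this.2], by linarith [this.1]⟩
  · rw [map_of_le hle]
    exact f.phiPlus.mem_Icc (stdBranch_mem_Icc hα f.v_mem f.c_mem.2 ⟨hle, hx.2⟩)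

theorem iterate_map_mem_Icc (hα : 0 < α) {x : ℝ} (hx : x ∈ Icc (0 : ℝ) 1) (k : ℕ) :
    f.map^[k] x ∈ Icc (0 : ℝ) 1 := by
  induction k with
  | zero => exact hx
  | succ k ih => rw [Function.iterate_succ_apply']; exact map_mem_Icc hα ih

theorem CloseToStandard.nearIdentity_plus {δ : ℝ} (h : f.CloseToStandard δ) :
    NearIdentity δ f.phiPlus.toFun (derivWithin f.phiPlus.toFun (Icc 0 1)) := h.2.nearIdentity

theorem CloseToStandard.nearIdentity_minus {δ : ℝ} (h : f.CloseToStandard δ) :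
    NearIdentity δ f.phiMinus.toFun (derivWithin f.phiMinus.toFun (Icc 0 1)) := h.1.nearIdentity

/-- The point `f p` lies between `c` and `f₋(c)`, and its image is still to the right of `c`. So the
right branch climbs by at least `c - f₊(c)` over a length at most `f₋(c) - c`, which the power law
at `c` limits. The orbit of `q` gives the mirror inequality; two intermediate steps on each side are
what this requires. -/
theorem critMargin_le_crit (hα : 1 < α) {c₀ p q : ℝ} {a b : ℕ} (hc₀ : 0 < c₀)
    (hc : f.c ∈ Icc c₀ (1 - c₀)) (hf : f.CloseToStandard ((α - 1) / (2 * α)))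
    (hp : 0 ≤ p) (hpc : p < f.c) (hcq : f.c < q) (hq : q ≤ 1) (hm : f.IsMonotoneType a b p q)
    (ha : 2 ≤ a) (hb : 2 ≤ b) :
    f.phiPlus.toFun (1 - f.v) ≤ f.c - critMargin α c₀ ∧
      f.c + critMargin α c₀ ≤ f.phiMinus.toFun f.u := by
  have hα0 : 0 < α := by linarith
  have hδ := half_sub_one_div_le_half hα
  have hc' : 1 - f.c < 1 := by linarith [f.c_mem.1]
  have hp1 : f.c < f.map p := by simpa using (hm.2.2.1 p ⟨le_rfl, hpc⟩).2 1 le_rfl (by omega)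
  have hp2 : f.c < f.map (f.map p) := by
    simpa using (hm.2.2.1 p ⟨le_rfl, hpc⟩).2 2 (by omega) ha
  have hq1 : f.map q < f.c := by simpa using (hm.2.2.2 q ⟨hcq, le_rfl⟩).2 1 le_rfl (by omega)
  have hq2 : f.map (f.map q) < f.c := by
    simpa using (hm.2.2.2 q ⟨hcq, le_rfl⟩).2 2 (by omega) hb
  have hpI := map_mem_Icc (f := f) hα0 ⟨hp, by linarith [f.c_mem.2]⟩
  have hqI := map_mem_Icc (f := f) hα0 (x := q) ⟨by linarith [f.c_mem.1], hq⟩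
  have hplus : f.phiPlus.toFun (1 - f.v) ≤ f.map q := by
    rw [map_of_le hcq.le]
    refine hf.nearIdentity_plus.monotone hδ (by linarith [f.v_mem.2]) ?_
      (stdBranch_mem_Icc hα0 f.v_mem f.c_mem.2 ⟨hcq.le, hq⟩).2
    rw [← stdBranch_crit hα0 (c := f.c)]
    exact stdBranch_mono hα0 f.v_mem.1 f.c_mem.2 le_rfl hcq.le
  have hminus : f.map p ≤ f.phiMinus.toFun f.u := by
    rw [map, if_pos hpc, std_of_lt hpc]
    have h1 := stdBranch_mem_Icc hα0 f.u_mem hc' (x := 1 - p) ⟨by linarith, by linarith⟩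
    have h2 := stdBranch_mono (x := 1 - f.c) (y := 1 - p) hα0 f.u_mem.1 hc' le_rfl (by linarith)
    rw [stdBranch_crit hα0] at h2
    exact hf.nearIdentity_minus.monotone hδ (by linarith [h1.2]) (by linarith) f.u_mem.2
  have h1 := hf.nearIdentity_plus.branch_sub_crit_le hδ hα0 hc₀ (by linarith [hc.2]) f.v_mem
    (x := f.map p) ⟨hp1.le, hpI.2⟩
  rw [← map_of_le hp1.le] at h1
  have h2 := hf.nearIdentity_minus.flip.branch_sub_crit_le hδ hα0 hc₀ (c := 1 - f.c)
    (by linarith [hc.1]) f.u_mem (x := 1 - f.map q) ⟨by linarith, by linarith [hqI.1]⟩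
  rw [← one_sub_map_of_lt hq1, sub_sub_cancel] at h2
  have hx : 0 < f.c - f.phiPlus.toFun (1 - f.v) := by linarith
  have hy : 0 < f.phiMinus.toFun f.u - f.c := by linarith
  have hx1 := (f.phiPlus.mem_Icc (x := 1 - f.v) ⟨by linarith [f.v_mem.2], by linarith [f.v_mem.1]⟩).1
  have hy1 := (f.phiMinus.mem_Icc f.u_mem).2
  have h1' : f.c - f.phiPlus.toFun (1 - f.v) ≤ 2 * ((f.phiMinus.toFun f.u - f.c) / c₀) ^ α := by
    have : (f.map p - f.c) / c₀ ≤ (f.phiMinus.toFun f.u - f.c) / c₀ := by gcongr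
    have := Real.rpow_le_rpow (div_nonneg (by linarith) hc₀.le) this hα0.le
    linarith
  have h2' : f.phiMinus.toFun f.u - f.c ≤ 2 * ((f.c - f.phiPlus.toFun (1 - f.v)) / c₀) ^ α := by
    have : (1 - f.map q - (1 - f.c)) / c₀ ≤ (f.c - f.phiPlus.toFun (1 - f.v)) / c₀ :=
      div_le_div_of_nonneg_right (by linarith) hc₀.le
    have := Real.rpow_le_rpow (div_nonneg (by linarith) hc₀.le) this hα0.le
    linarith
  constructor
  · linarith [critMargin_le hα hc₀ hx hy (by linarith [f.c_mem.1]) h1' h2']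
  · linarith [critMargin_le hα hc₀ hy hx (by linarith [f.c_mem.2]) h2' h1']

theorem expandingBranch_plus (hα : 1 < α) {c₀ η : ℝ} (hc₀ : 0 < c₀) (hη : 0 < η)
    (hc : f.c ∈ Icc c₀ (1 - c₀)) (hf : f.CloseToStandard ((α - 1) / (2 * α)))
    (hcrit : f.phiPlus.toFun (1 - f.v) ≤ f.c - η) :
    ExpandingBranch α c₀ η f.v f.c f.phiPlus.toFun (derivWithin f.phiPlus.toFun (Icc 0 1)) where
  one_lt := hα
  near := hf.nearIdentity_plus
  c₀_pos := hc₀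
  c_nonneg := f.c_mem.1.le
  c₀_le := by linarith [hc.2]
  v_pos := by
    refine f.v_mem.1.lt_of_ne fun h => ?_
    rw [← h, sub_zero, f.phiPlus.map_one] at hcrit
    linarith [f.c_mem.2]
  v_le := f.v_mem.2
  η_pos := hη
  crit := hcrit

theorem expandingBranch_minus (hα : 1 < α) {c₀ η : ℝ} (hc₀ : 0 < c₀) (hη : 0 < η)
    (hc : f.c ∈ Icc c₀ (1 - c₀)) (hf : f.CloseToStandard ((α - 1) / (2 * α)))
    (hcrit : f.c + η ≤ f.phiMinus.toFun f.u) :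
    ExpandingBranch α c₀ η f.u (1 - f.c) (fun x => 1 - f.phiMinus.toFun (1 - x))
      (fun x => derivWithin f.phiMinus.toFun (Icc 0 1) (1 - x)) where
  one_lt := hα
  near := hf.nearIdentity_minus.flip
  c₀_pos := hc₀
  c_nonneg := by linarith [f.c_mem.2]
  c₀_le := by linarith [hc.1]
  v_pos := by
    refine f.u_mem.1.lt_of_ne fun h => ?_
    rw [← h, f.phiMinus.map_zero] at hcrit
    linarith [f.c_mem.1]
  v_le := f.u_mem.2
  η_pos := hη
  crit := by simp only [sub_sub_cancel]; linarith

end LorenzMap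

/-! ### Size of `C`, gaps, and diffeomorphic parts of the renormalization -/

theorem ExpandingBranch.add_le_orbit {α c₀ η v c : ℝ} {φ D : ℝ → ℝ}
    (h : ExpandingBranch α c₀ η v c φ D) {X : ℕ → ℝ} {a : ℕ} (hX : ∀ k < a, X k ∈ Icc c 1)
    (hX' : ∀ k < a, X (k + 1) = φ (stdBranch α v c (X k))) (hXa : c - η / 2 ≤ X a) {k : ℕ}
    (hk : k < a) : c + orbitMargin α η * c₀ ≤ X k := by
  have h1 := h.orbitMargin_le hX hX' hXa hk
  rw [le_div_iff₀ (by linarith [h.c_lt])] at h1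
  nlinarith [orbitMargin_pos (α := α) h.η_pos, h.c₀_le]

/-- The rescaled composition of many expanding branches has small logarithmic variation of the
derivative. -/
theorem ExpandingBranch.abs_log_deriv_sub_le_mul {α c₀ η v c δ s t p q E : ℝ} {φ D : ℝ → ℝ}
    (h : ExpandingBranch α c₀ η v c φ D) {a : ℕ} {ψ Dψ G DG : ℝ → ℝ} {X : ℕ → ℝ → ℝ}
    (hψ : NearIdentity δ ψ Dψ) (hδ : δ ≤ 1 / 2) (ha : 1 ≤ a)
    (hs : 0 ≤ s) (hst : s < t) (ht : t ≤ 1) (hpq : p < q) (hp : c - η / 2 ≤ p)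
    (hG : ∀ y ∈ Icc (0 : ℝ) 1, HasDerivWithinAt G (DG y) (Icc 0 1) y)
    (hG0 : ∀ y ∈ Icc (0 : ℝ) 1, 0 ≤ G y) (hDG : ∀ y ∈ Icc (0 : ℝ) 1, 0 < DG y)
    (hX0 : ∀ y ∈ Icc (0 : ℝ) 1, X 0 y = ψ (s + (t - s) * y))
    (hX : ∀ k < a, ∀ y ∈ Icc (0 : ℝ) 1, X k y ∈ Ioc c 1)
    (hX' : ∀ k < a, ∀ y ∈ Icc (0 : ℝ) 1, X (k + 1) y = φ (stdBranch α v c (X k y)))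
    (hXa : ∀ y ∈ Icc (0 : ℝ) 1, X a y = p + (q - p) * G y)
    (hE : 2 * (1 + η)⁻¹ ^ (a - 1) ≤ E)
    (hE' : logDerivLip α c₀ η * orbitConst α c₀ η * (q - p) ≤ E)
    {y y' : ℝ} (hy : y ∈ Icc (0 : ℝ) 1) (hy' : y' ∈ Icc (0 : ℝ) 1) :
    |Real.log (DG y) - Real.log (DG y')| ≤ E * (|G y - G y'| + |y - y'|) := by
  have h1 := h.abs_log_deriv_sub_le hψ hδ hs hst ht hpq hp hG hG0 hDG hX0
    (fun k hk y hy => (hX k hk y hy).1) hX' hXa hy hy'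
  have h0 : (0 : ℝ) ∈ Icc (0 : ℝ) 1 := by simp
  -- The orbit starting at the left endpoint `s` forces `s` close to `1`, hence `t - s ≤ 1 - s` is
  -- small and `ψ` contributes little distortion.
  have h2 := h.one_sub_le_of_orbit hψ hδ ha (y := s) ⟨hs, by linarith⟩ (X := fun k => X k 0)
    (by simpa using hX0 0 h0) (fun k hk => Ioc_subset_Icc_self (hX k hk 0 h0))
    (fun k hk => hX' k hk 0 h0)
  have h3 : (t - s) * |y - y'| ≤ E * |y - y'| :=
    mul_le_mul_of_nonneg_right (by linarith) (abs_nonneg _)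
  have h4 := mul_le_mul_of_nonneg_right hE' (abs_nonneg (G y - G y'))
  linarith

namespace LorenzMap

variable {α : ℝ} {f : LorenzMap α}

theorem IsMonotoneType.orbit_plus {a b : ℕ} {p q x : ℝ} (hm : f.IsMonotoneType a b p q)
    (hα : 0 < α) (hp : 0 ≤ p) (hx : x ∈ Ico p f.c) :
    (∀ k < a, f.map^[k + 1] x ∈ Icc f.c 1) ∧
    (∀ k < a, f.map^[k + 1 + 1] x = f.phiPlus.toFun (stdBranch α f.v f.c (f.map^[k + 1] x))) ∧
    f.map^[a + 1] x ∈ Icc p q := by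
  obtain ⟨h1, h2⟩ := hm.2.2.1 x hx
  have h3 : ∀ k < a, f.map^[k + 1] x ∈ Icc f.c 1 := fun k hk =>
    ⟨(h2 (k + 1) (by omega) hk).le, (iterate_map_mem_Icc hα
      ⟨hp.trans hx.1, by linarith [hx.2, f.c_mem.2]⟩ _).2⟩
  refine ⟨h3, fun k hk => ?_, h1.2.1⟩
  rw [Function.iterate_succ_apply' f.map (k + 1), map_of_le (h3 k hk).1]

theorem IsMonotoneType.orbit_minus {a b : ℕ} {p q x : ℝ} (hm : f.IsMonotoneType a b p q)
    (hα : 0 < α) (hq : q ≤ 1) (hx : x ∈ Ioc f.c q) :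
    (∀ k < b, 1 - f.map^[k + 1] x ∈ Icc (1 - f.c) 1) ∧
    (∀ k < b, 1 - f.map^[k + 1 + 1] x = 1 - f.phiMinus.toFun
      (1 - stdBranch α f.u (1 - f.c) (1 - f.map^[k + 1] x))) ∧
    f.map^[b + 1] x ∈ Icc p q := by
  obtain ⟨h1, h2⟩ := hm.2.2.2 x hx
  refine ⟨fun k hk => ⟨by linarith [h2 (k + 1) (by omega) hk], ?_⟩, fun k hk => ?_, h1.2.1⟩
  · linarith [(iterate_map_mem_Icc hα (f := f) (x := x)
      ⟨by linarith [hx.1, f.c_mem.1], hx.2.trans hq⟩ (k + 1)).1]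
  · rw [Function.iterate_succ_apply' f.map (k + 1), one_sub_map_of_lt (h2 (k + 1) (by omega) hk)]

/-- The `a` steps to the right of `c` push the standard part of `p` exponentially close to `1`.
Since `u ≤ 1`, its distance to `1` is at least `((c - p)/c) ^ α`; taking the root gives the bound.
-/
theorem c_sub_le {c₀ η p q : ℝ} {a b : ℕ} {D : ℝ → ℝ}
    (h : ExpandingBranch α c₀ η f.v f.c f.phiPlus.toFun D)
    (hf : f.CloseToStandard ((α - 1) / (2 * α))) (hm : f.IsMonotoneType a b p q)
    (hp : 0 ≤ p) (hpc : p < f.c) : f.c - p ≤ (2 * (1 + η)⁻¹ ^ (a - 1)) ^ (1 / α) := by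
  obtain ⟨h1, h2, -⟩ := hm.orbit_plus h.α_pos hp ⟨le_rfl, hpc⟩
  have hc := f.c_mem.1
  have hz := div_mem_Icc (c := 1 - f.c) (x := 1 - p) (by linarith) ⟨by linarith, by linarith⟩
  have hq := stdBranch_mem_Icc (c := 1 - f.c) (x := 1 - p) h.α_pos f.u_mem (by linarith)
    ⟨by linarith, by linarith⟩
  have h3 := h.one_sub_le_of_orbit hf.nearIdentity_minus h.δ_le hm.1 (X := fun k => f.map^[k + 1] p)
    (y := f.std p) (by rw [std_of_lt hpc]; exact ⟨by linarith [hq.2], by linarith [hq.1]⟩)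
    (by simp [map, hpc]) h1 h2
  rw [std_of_lt hpc, sub_sub_cancel] at h3
  have h4 : ((1 - p - (1 - f.c)) / (1 - (1 - f.c))) ^ α ≤ stdBranch α f.u (1 - f.c) (1 - p) := by
    have := Real.rpow_le_one hz.1 hz.2 h.α_pos.le
    unfold stdBranch
    nlinarith [f.u_mem.2]
  refine le_trans ?_ (le_rpow_one_div h.α_pos hz.1 (h4.trans h3))
  rw [le_div_iff₀ (by linarith)]
  nlinarith [f.c_mem.2]

theorem sub_c_le {c₀ η p q : ℝ} {a b : ℕ} {D : ℝ → ℝ}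
    (h : ExpandingBranch α c₀ η f.u (1 - f.c) (fun x => 1 - f.phiMinus.toFun (1 - x)) D)
    (hf : f.CloseToStandard ((α - 1) / (2 * α))) (hm : f.IsMonotoneType a b p q)
    (hq : q ≤ 1) (hcq : f.c < q) : q - f.c ≤ (2 * (1 + η)⁻¹ ^ (b - 1)) ^ (1 / α) := by
  obtain ⟨h1, h2, -⟩ := hm.orbit_minus h.α_pos hq ⟨hcq, le_rfl⟩
  have hc := f.c_mem.2
  have hz := div_mem_Icc hc (x := q) ⟨hcq.le, hq⟩
  have hq := stdBranch_mem_Icc h.α_pos f.v_mem hc (x := q) ⟨hcq.le, hq⟩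
  have h3 := h.one_sub_le_of_orbit hf.nearIdentity_plus.flip h.δ_le hm.2.1
    (X := fun k => 1 - f.map^[k + 1] q) (y := 1 - stdBranch α f.v f.c q)
    ⟨by linarith [hq.2], by linarith [hq.1]⟩
    (by simp [map_of_le hcq.le]) h1 h2
  rw [sub_sub_cancel] at h3
  have h4 : ((q - f.c) / (1 - f.c)) ^ α ≤ stdBranch α f.v f.c q := by
    have := Real.rpow_le_one hz.1 hz.2 h.α_pos.le
    unfold stdBranch
    nlinarith [f.v_mem.2]
  refine le_trans ?_ (le_rpow_one_div h.α_pos hz.1 (h4.trans h3))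
  rw [le_div_iff₀ (by linarith)]
  nlinarith [f.c_mem.1]

/-- The cycle of `C⁺` stays in `(-∞, q]`, and that of `C⁻` does so only at time `0`; at later times
it lies beyond `c + orbitMargin α η * c₀`. Nothing meets the interval between. -/
theorem le_volume_rightGap {c₀ η p q m : ℝ} {a b : ℕ} {D : ℝ → ℝ}
    (h : ExpandingBranch α c₀ η f.v f.c f.phiPlus.toFun D) (hm : f.IsMonotoneType a b p q)
    (hp : 0 ≤ p) (hpc : p < f.c) (hcq : f.c < q) (hη : f.c - p ≤ η / 2)
    (hqm : q + m ≤ f.c + orbitMargin α η * c₀) :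
    m ≤ volume.real (f.rightGap a b p q) := by
  rcases le_or_gt m 0 with hm0 | hm0
  · exact hm0.trans measureReal_nonneg
  have hlow : ∀ x ∈ Ico p f.c, ∀ k < a, f.c + orbitMargin α η * c₀ ≤ f.map^[k + 1] x := by
    intro x hx k hk
    obtain ⟨h1, h2, h3⟩ := hm.orbit_plus h.α_pos hp hx
    exact h.add_le_orbit (X := fun k => f.map^[k + 1] x) h1 h2 (by linarith [h3.1]) hk
  have h1 : q + m ≤ 1 := by
    obtain ⟨h1, -, -⟩ := hm.orbit_plus h.α_pos hp ⟨le_rfl, hpc⟩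
    linarith [(h1 0 hm.1).2, hlow p ⟨le_rfl, hpc⟩ 0 hm.1]
  have hsub : Ioo q (q + m) ⊆ f.rightGap a b p q := by
    rintro x ⟨hx1, hx2⟩
    refine ⟨hx1, by linarith, fun y hy hmem => ?_⟩
    have hy1 : q < y := hy.1
    have hy2 : y < q + m := hy.2.trans_lt hx2
    simp only [cycles, mem_union, mem_iUnion, Finset.mem_range] at hmem
    rcases hmem with ⟨k, hk, hmem⟩ | ⟨k, hk, hmem⟩
    · have : closure (f.map^[k] '' Ico p f.c) ⊆ Iic q ∪ Ici (q + m) := by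
        refine closure_minimal ?_ (isClosed_Iic.union isClosed_Ici)
        rintro _ ⟨w, hw, rfl⟩
        rcases k with _ | k
        · exact Or.inl (by simpa using hw.2.le.trans hcq.le)
        · exact Or.inr (hqm.trans (hlow w hw k (by omega)))
      rcases this hmem with h' | h'
      · exact absurd hy1 (not_lt.2 h')
      · exact absurd hy2 (not_lt.2 h')
    · have : closure (f.map^[k] '' Ioc f.c q) ⊆ Iic q := by
        refine closure_minimal ?_ isClosed_Iic
        rintro _ ⟨w, hw, rfl⟩
        rcases k with _ | k
        · exact hw.2
        · exact ((hm.2.2.2 w hw).2 (k + 1) (by omega) (by omega)).le.trans hcq.le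
      exact absurd hy1 (not_lt.2 (this hmem))
  have hfin : volume (f.rightGap a b p q) ≠ ⊤ :=
    ((measure_mono fun x hx => (⟨hx.1.le, hx.2.1⟩ : x ∈ Icc q 1)).trans_lt
      measure_Icc_lt_top).ne
  have := measureReal_mono hsub hfin
  rwa [Real.volume_real_Ioo_of_le (by linarith), add_sub_cancel_left] at this

theorem le_volume_leftGap {c₀ η p q m : ℝ} {a b : ℕ} {D : ℝ → ℝ}
    (h : ExpandingBranch α c₀ η f.u (1 - f.c) (fun x => 1 - f.phiMinus.toFun (1 - x)) D)
    (hm : f.IsMonotoneType a b p q)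
    (hq : q ≤ 1) (hpc : p < f.c) (hcq : f.c < q) (hη : q - f.c ≤ η / 2)
    (hpm : f.c - orbitMargin α η * c₀ ≤ p - m) :
    m ≤ volume.real (f.leftGap a b p q) := by
  rcases le_or_gt m 0 with hm0 | hm0
  · exact hm0.trans measureReal_nonneg
  have hlow : ∀ x ∈ Ioc f.c q, ∀ k < b, f.map^[k + 1] x ≤ f.c - orbitMargin α η * c₀ := by
    intro x hx k hk
    obtain ⟨h1, h2, h3⟩ := hm.orbit_minus h.α_pos hq hx
    linarith [h.add_le_orbit (X := fun k => 1 - f.map^[k + 1] x) h1 h2 (by linarith [h3.2]) hk]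
  have h1 : 0 ≤ p - m := by
    obtain ⟨h1, -, -⟩ := hm.orbit_minus h.α_pos hq ⟨hcq, le_rfl⟩
    linarith [(h1 0 hm.2.1).2, hlow q ⟨hcq, le_rfl⟩ 0 hm.2.1]
  have hsub : Ioo (p - m) p ⊆ f.leftGap a b p q := by
    rintro x ⟨hx1, hx2⟩
    refine ⟨by linarith, hx2, fun y hy hmem => ?_⟩
    have hy1 : y < p := hy.2
    have hy2 : p - m < y := hx1.trans_le hy.1
    simp only [cycles, mem_union, mem_iUnion, Finset.mem_range] at hmem
    rcases hmem with ⟨k, hk, hmem⟩ | ⟨k, hk, hmem⟩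
    · have : closure (f.map^[k] '' Ico p f.c) ⊆ Ici p := by
        refine closure_minimal ?_ isClosed_Ici
        rintro _ ⟨w, hw, rfl⟩
        rcases k with _ | k
        · exact hw.1
        · exact hpc.le.trans ((hm.2.2.1 w hw).2 (k + 1) (by omega) (by omega)).le
      exact absurd hy1 (not_lt.2 (this hmem))
    · have : closure (f.map^[k] '' Ioc f.c q) ⊆ Ici p ∪ Iic (p - m) := by
        refine closure_minimal ?_ (isClosed_Ici.union isClosed_Iic)
        rintro _ ⟨w, hw, rfl⟩
        rcases k with _ | k
        · exact Or.inl (by simpa using hpc.le.trans hw.1.le)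
        · exact Or.inr ((hlow w hw k (by omega)).trans hpm)
      rcases this hmem with h' | h'
      · exact absurd hy1 (not_lt.2 h')
      · exact absurd hy2 (not_lt.2 h')
  have hfin : volume (f.leftGap a b p q) ≠ ⊤ :=
    ((measure_mono fun x hx => (⟨hx.1, hx.2.1.le⟩ : x ∈ Icc 0 p)).trans_lt
      measure_Icc_lt_top).ne
  have := measureReal_mono hsub hfin
  rwa [Real.volume_real_Ioo_of_le (by linarith), sub_sub_cancel] at this

theorem phiMinus_closeToId {c₀ η p q E : ℝ} {a b : ℕ} {D : ℝ → ℝ} {g : LorenzMap α}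
    (h : ExpandingBranch α c₀ η f.v f.c f.phiPlus.toFun D)
    (hf : f.CloseToStandard ((α - 1) / (2 * α))) (hg : f.HasInducedParts a b p q g) (ha : 1 ≤ a)
    (hpq : p < q) (hη : f.c - p ≤ η / 2) (hE4 : E ≤ 1 / 4)
    (hE : 2 * (1 + η)⁻¹ ^ (a - 1) ≤ E)
    (hE' : logDerivLip α c₀ η * orbitConst α c₀ η * (q - p) ≤ E) :
    g.phiMinus.CloseToId (12 * E) := by
  obtain ⟨⟨s, t, hs, hst, ht, hX, -⟩, -⟩ := hg
  refine g.phiMinus.closeToId_of_abs_log_deriv_sub_le hE4 fun y hy y' hy' =>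
    h.abs_log_deriv_sub_le_mul hf.nearIdentity_minus h.δ_le ha hs hst ht hpq (by linarith)
      (fun y hy => g.phiMinus.hasDerivWithinAt hy) (fun y hy => (g.phiMinus.mem_Icc hy).1)
      g.phiMinus.deriv_pos
      (X := fun k y => f.map^[k] (f.phiMinus.toFun (s + (t - s) * y))) (fun y hy => rfl)
      (fun k hk y hy => ⟨(hX y hy).1 k hk, (iterate_map_mem_Icc h.α_pos
        (f.phiMinus.mem_Icc ⟨?_, ?_⟩) k).2⟩) (fun k hk y hy => ?_)
      (fun y hy => (hX y hy).2) hE hE' hy hy'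
  · nlinarith [hy.1]
  · nlinarith [hy.2]
  · rw [Function.iterate_succ_apply', map_of_le ((hX y hy).1 k hk).le]

theorem phiPlus_closeToId {c₀ η p q E : ℝ} {a b : ℕ} {D : ℝ → ℝ} {g : LorenzMap α}
    (h : ExpandingBranch α c₀ η f.u (1 - f.c) (fun x => 1 - f.phiMinus.toFun (1 - x)) D)
    (hf : f.CloseToStandard ((α - 1) / (2 * α))) (hg : f.HasInducedParts a b p q g) (hb : 1 ≤ b)
    (hpq : p < q) (hη : q - f.c ≤ η / 2) (hE4 : E ≤ 1 / 4)
    (hE : 2 * (1 + η)⁻¹ ^ (b - 1) ≤ E)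
    (hE' : logDerivLip α c₀ η * orbitConst α c₀ η * (q - p) ≤ E) :
    g.phiPlus.CloseToId (12 * E) := by
  obtain ⟨-, s, t, hs, hst, ht, hX, -⟩ := hg
  have hflip : ∀ y ∈ Icc (0 : ℝ) 1, 1 - y ∈ Icc (0 : ℝ) 1 := fun y hy =>
    ⟨by linarith [hy.2], by linarith [hy.1]⟩
  refine g.phiPlus.closeToId_of_abs_log_deriv_sub_le hE4 fun y hy y' hy' => ?_
  have hder : ∀ y ∈ Icc (0 : ℝ) 1, HasDerivWithinAt (fun y => 1 - g.phiPlus.toFun (1 - y))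
      (derivWithin g.phiPlus.toFun (Icc 0 1) (1 - y)) (Icc 0 1) y := fun y hy => by
    have h1 : HasDerivWithinAt (fun y : ℝ => 1 - y) (-1) (Icc 0 1) y := by
      simpa using (hasDerivWithinAt_id y (Icc (0 : ℝ) 1)).const_sub 1
    simpa [Function.comp_def] using
      ((g.phiPlus.hasDerivWithinAt (hflip y hy)).comp y h1 hflip).const_sub 1
  -- Under `x ↦ 1 - x` the intervals `[s, t]` and `[p, q]` become `[1 - t, 1 - s]` and `[1 - q, 1 -
  -- p]`.
  have key := h.abs_log_deriv_sub_le_mul hf.nearIdentity_plus.flip h.δ_le hb (s := 1 - t)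
      (t := 1 - s) (p := 1 - q) (q := 1 - p)
      (by linarith) (by linarith) (by linarith) (by linarith) (by linarith) hder
      (fun y hy => by linarith [(g.phiPlus.mem_Icc (hflip y hy)).2])
      (fun y hy => g.phiPlus.deriv_pos _ (hflip y hy))
      (X := fun k y => 1 - f.map^[k] (f.phiPlus.toFun (s + (t - s) * (1 - y))))
      (fun y hy => by
        rw [show 1 - (1 - t + (1 - s - (1 - t)) * y) = s + (t - s) * (1 - y) by ring]; rfl)
      (fun k hk y hy => by
        have hy' := hflip y hy
        have h1 := (hX _ hy').1 k hk
        have h2 := (iterate_map_mem_Icc (f := f) h.α_pos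
          (f.phiPlus.mem_Icc (x := s + (t - s) * (1 - y))
            ⟨by nlinarith [hy'.1], by nlinarith [hy'.2]⟩) k).1
        exact ⟨by linarith, by linarith⟩)
      (fun k hk y hy => by
        rw [Function.iterate_succ_apply', one_sub_map_of_lt ((hX _ (hflip y hy)).1 k hk)])
      (fun y hy => by rw [(hX _ (hflip y hy)).2]; ring) hE
      (by rwa [show 1 - p - (1 - q) = q - p by ring]) (hflip y hy) (hflip y' hy')
  simp only [sub_sub_cancel] at key
  rwa [show 1 - g.phiPlus.toFun y - (1 - g.phiPlus.toFun y')
    = -(g.phiPlus.toFun y - g.phiPlus.toFun y') by ring, abs_neg,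
    show 1 - y - (1 - y') = -(y - y') by ring, abs_neg] at key

/-! ### Uniform estimates and the main theorem -/

theorem _root_.LorenzDiffeo.CloseToId.mono {φ : LorenzDiffeo} {ε ε' : ℝ} (h : φ.CloseToId ε)
    (hε : ε ≤ ε') : φ.CloseToId ε' := fun x hx =>
  ⟨(h x hx).1.trans hε, (h x hx).2.1.trans hε, (h x hx).2.2.trans hε⟩

/-- Renormalizations of high monotone type have large gaps and are close to standard maps,
uniformly over all maps whose critical point stays away from the boundary. -/
theorem exists_forall_isRenormalization_estimates (hα : 1 < α) {c₀ ε : ℝ} (hc₀ : 0 < c₀)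
    (hε : 0 < ε) : ∃ N : ℕ, 1 ≤ N ∧ ∀ a b : ℕ, N ≤ a → N ≤ b → ∀ f : LorenzMap α,
      f.c ∈ Icc c₀ (1 - c₀) → f.CloseToStandard ((α - 1) / (2 * α)) →
      ∀ (p q : ℝ) (g : LorenzMap α), f.IsRenormalization a b p q g →
        0 < volume.real (f.leftGap a b p q) ∧ 0 < volume.real (f.rightGap a b p q) ∧
        max ((q - p) / volume.real (f.leftGap a b p q))
          ((q - p) / volume.real (f.rightGap a b p q)) ≤ ε ∧
        g.CloseToStandard ε := by
  have hα0 : 0 < α := by linarith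
  set η := critMargin α c₀ with hηdef
  have hη : 0 < η := critMargin_pos hc₀
  set m := orbitMargin α η * c₀ with hmdef
  have hm : 0 < m := mul_pos (orbitMargin_pos hη) hc₀
  set K := |logDerivLip α c₀ η * orbitConst α c₀ η| with hK
  set E := min (1 / 4) (ε / 12) with hE
  have hE0 : 0 < E := by positivity
  -- `σ` bounds each half of `C`. Its four terms serve, in order: final orbit points beyond `c ∓
  -- η/2`, gaps of length at least `m/2`, the ratio `ε`, and total distortion at most `E`.
  set σ := min (min (η / 2) (m / 2)) (min (ε * m / 4) (E / (2 * (K + 1)))) with hσ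
  have hK0 : 0 ≤ K := abs_nonneg _
  have hσ0 : 0 < σ := by positivity
  have hr0 : 0 < (1 + η)⁻¹ := by positivity
  have hr1 : (1 + η)⁻¹ < 1 := inv_lt_one_of_one_lt₀ (by linarith)
  have hlim : Tendsto (fun n : ℕ => 2 * (1 + η)⁻¹ ^ (n - 1)) atTop (𝓝 0) := by
    have := ((tendsto_pow_atTop_nhds_zero_of_lt_one hr0.le hr1).comp
      (tendsto_sub_atTop_nat 1)).const_mul 2
    simpa using this
  have hlim' : Tendsto (fun n : ℕ => (2 * (1 + η)⁻¹ ^ (n - 1)) ^ (1 / α)) atTop (𝓝 0) := by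
    have := hlim.rpow_const (p := 1 / α) (Or.inr (by positivity))
    rwa [Real.zero_rpow (by positivity)] at this
  obtain ⟨N, hN⟩ := eventually_atTop.1 ((hlim.eventually_le_const hE0).and
    (hlim'.eventually_le_const hσ0))
  -- The shift by `2` provides the two intermediate steps needed by `critMargin_le_crit`.
  refine ⟨N + 2, by omega, fun a b ha hb f hc hf p q g hren => ?_⟩
  obtain ⟨⟨⟨hp, hpc, hcq, hq, -, -⟩, -⟩, hmono, -, hind⟩ := hren
  obtain ⟨hcr1, hcr2⟩ := critMargin_le_crit hα hc₀ hc hf hp hpc hcq hq hmono (by omega) (by omega)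
  have hplus := expandingBranch_plus hα hc₀ hη hc hf hcr1
  have hminus := expandingBranch_minus hα hc₀ hη hc hf hcr2
  have hp' := (c_sub_le hplus hf hmono hp hpc).trans (hN a (by omega)).2
  have hq' := (sub_c_le hminus hf hmono hq hcq).trans (hN b (by omega)).2
  have hσ1 : σ ≤ η / 2 := (min_le_left _ _).trans (min_le_left _ _)
  have hσ2 : σ ≤ m / 2 := (min_le_left _ _).trans (min_le_right _ _)
  have hσ3 : σ ≤ ε * m / 4 := (min_le_right _ _).trans (min_le_left _ _)
  have hσ4 : σ ≤ E / (2 * (K + 1)) := (min_le_right _ _).trans (min_le_right _ _)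
  have hgl : m / 2 ≤ volume.real (f.leftGap a b p q) :=
    le_volume_leftGap hminus hmono hq hpc hcq (by linarith) (by linarith)
  have hgr : m / 2 ≤ volume.real (f.rightGap a b p q) :=
    le_volume_rightGap hplus hmono hp hpc hcq (by linarith) (by linarith)
  have hratio : ∀ V, m / 2 ≤ V → (q - p) / V ≤ ε := fun V hV => by
    rw [div_le_iff₀ (by linarith)]
    nlinarith
  have hKE : logDerivLip α c₀ η * orbitConst α c₀ η * (q - p) ≤ E := by
    have h1 : logDerivLip α c₀ η * orbitConst α c₀ η * (q - p) ≤ K * (2 * σ) :=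
      mul_le_mul (le_abs_self _) (by linarith) (by linarith) hK0
    rw [le_div_iff₀ (by positivity)] at hσ4
    nlinarith
  have hE12 : 12 * E ≤ ε := by linarith [min_le_right (1 / 4) (ε / 12)]
  exact ⟨by linarith, by linarith, max_le (hratio _ hgl) (hratio _ hgr),
    (phiMinus_closeToId hplus hf hind (by omega) (by linarith) (by linarith) (min_le_left _ _)
      (hN a (by omega)).1 hKE).mono hE12,
    (phiPlus_closeToId hminus hf hind (by omega) (by linarith) (by linarith) (min_le_left _ _)
      (hN b (by omega)).1 hKE).mono hE12⟩

theorem IsFamily.exists_c_mem_Icc {U : Set (ℝ × ℝ)} {F : ℝ × ℝ → LorenzMap α} (h : IsFamily U F) :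
    ∃ c₀ > 0, ∀ l ∈ U, (F l).c ∈ Icc c₀ (1 - c₀) := by
  rcases U.eq_empty_or_nonempty with rfl | hne
  · exact ⟨1, one_pos, by simp⟩
  obtain ⟨l₁, -, h₁⟩ := h.compact.exists_isMinOn hne h.continuous_c
  obtain ⟨l₂, -, h₂⟩ := h.compact.exists_isMaxOn hne h.continuous_c
  refine ⟨min (F l₁).c (1 - (F l₂).c), lt_min (F l₁).c_mem.1 (by linarith [(F l₂).c_mem.2]),
    fun l hl => ⟨(min_le_left _ _).trans (h₁ hl), ?_⟩⟩
  have := h₂ hl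
  simp only [mem_ofPred_eq] at this
  linarith [min_le_right (F l₁).c (1 - (F l₂).c)]

theorem IsIsland.subset {U D : Set (ℝ × ℝ)} {F : ℝ × ℝ → LorenzMap α} {a b : ℕ}
    (h : IsIsland U F a b D) (hU : IsClosed U) : D ⊆ U := by
  obtain ⟨l, -, rfl⟩ := h
  exact closure_minimal ((connectedComponentIn_subset _ _).trans
    (interior_subset.trans fun _ hx => hx.1)) hU

end LorenzMap

theorem mainTheorem7 (α : ℝ) (hα : 1 < α) :
    ∃ δ : ℝ, 0 < δ ∧ ∀ (U : Set (ℝ × ℝ)) (F : ℝ × ℝ → LorenzMap α),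
      LorenzMap.IsFullFamily U F → LorenzMap.IsAnalyticFamily U F →
      (∀ l ∈ U, (F l).CloseToStandard δ) →
      ∀ ε : ℝ, 0 < ε → ∃ N : ℕ, 1 ≤ N ∧ ∀ a b : ℕ, N ≤ a → N ≤ b →
        ∀ D : Set (ℝ × ℝ), LorenzMap.IsFullIsland U F a b D → ∀ l ∈ D,
          ∃ (p q : ℝ) (g : LorenzMap α), (F l).IsRenormalization a b p q g ∧
            0 < volume.real ((F l).leftGap a b p q) ∧
            0 < volume.real ((F l).rightGap a b p q) ∧
            max ((q - p) / volume.real ((F l).leftGap a b p q))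
              ((q - p) / volume.real ((F l).rightGap a b p q)) ≤ ε ∧
            g.CloseToStandard ε := by
  -- The largest `δ` for which the argument of `branchDeriv_mono` yields convex right branches.
  refine ⟨(α - 1) / (2 * α), div_pos (by linarith) (by linarith), ?_⟩
  intro U F hfull _ hclose ε hε
  obtain ⟨c₀, hc₀, hc⟩ := hfull.1.exists_c_mem_Icc
  obtain ⟨N, hN1, hN⟩ := LorenzMap.exists_forall_isRenormalization_estimates hα hc₀ hε
  refine ⟨N, hN1, fun a b ha hb D ⟨hisl, R, hR, _⟩ l hl => ?_⟩
  -- An island is a closure, so its boundary maps obey the bounds on `c` and on closeness only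
  -- because `U` is closed.
  have hlU := hisl.subset hfull.1.compact.isClosed hl
  obtain ⟨p, q, hren⟩ := hR l hl
  exact ⟨p, q, R l, hren, hN a b ha hb (F l) (hc l hlU) (hclose l hlU) p q (R l) hren⟩
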